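/- **Setting.** Let $m\ge 1$ and let $D_1,\dots,D_{2m}\subset\mathbb{C}$ be open Euclidean disks with centers on the real line and pairwise disjoint closures. For $1\le j\le m$ let $\gamma_j\in \mathrm{SL}_2(\mathbb{R})$, acting by Möbius transformations, map the exterior of $D_j$ (in $\mathbb{C}\cup\{\infty\}$) onto the interior of $D_{j+m}$, and put $\gamma_{j+m}=\gamma_j^{-1}$ (indices modulo $2m$). Let $\Gamma<\mathrm{SL}_2(\mathbb{R})$ be the Schottky group generated by the $\gamma_j$, $\Lambda\subset\mathbb{R}$ its limit set (the set of accumulation points of orbits of $\Gamma$ in the hyperbolic upper half-plane), and $\delta$ the Hausdorff dimension of $\Lambda$. Put $D=\bigcup_j D_j$, $I_j=D_j\cap\mathbb{R}$, $I=\bigcup_j I_j$. For a word $\mathbf a=a_1\cdots a_N$ in the letters $1,\dots,2m$ put $\gamma_{\mathbf a}=\gamma_{a_1}\circ\cdots\circ\gamma_{a_N}$, and let $W_N^j$ be the set of words $\mathbf a$ of length $N$ that are reduced ($a_i\not\equiv a_{i+1}+m \bmod 2m$ for $1\le i<N$) and satisfy $a_N\neq j$. For $\sigma\in\mathbb{R}$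 let $\mathcal{L}_\sigma\varphi(x)=\sum_{i\ne j}\gamma_i'(x)^\sigma\varphi(\gamma_i(x))$ for $x\in I_j$, and let $$P(\sigma)=\lim_{N\to\infty}\frac1N\log\sum_{T^Nx=x}\exp\Big(-\sigma\sum_{k=0}^{N-1}\log|T'(T^kx)|\Big)$$ be the topological pressure of the Bowen–Series map $T$, $T(x)=\gamma_j(x)$ for $x\in I_j$. Let $\varphi_\sigma\in C^1(I)$ be a strictly positive function with $\mathcal{L}_\sigma\varphi_\sigma=e^{P(\sigma)}\varphi_\sigma$ on $I$ (the Ruelle–Perron–Frobenius eigenfunction). For a finite-dimensional unitary representation $(\rho,V)$ of $\Gamma$ and $s=\sigma+it\in\mathbb{C}$, the twisted transfer operator is $$\mathcal{L}_{s,\rho}F(z)=\sum_{i\neq j}\gamma_i'(z)^s\,\rho(\gamma_i)^{-1}F(\gamma_i(z)),\qquad z\in D_j,$$ on the space $H^2(D,V)$ of square-integrable holomorphic functions $F\colon D\to V$; a 1-eigenfunction is a non-zero $F\in H^2(D,V)$ with $\mathcal{L}_{s,\rho}F=F$. Write $\|f\|_{\infty,\Lambda}=\max_{y\in\Lambda}\|f(y)\|_V$.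 **Proposition 4.1 (Strict convexity).** There is a constant $C>0$ depending only on $\Gamma$ (with its Schottky data) such that the following holds. Let $(\rho,V)$ be a finite-dimensional unitary representation of $\Gamma$, let $s=\sigma+it$ with $\sigma\in[0,\delta]$, and let $F\in H^2(D,V)$ be a 1-eigenfunction of $\mathcal{L}_{s,\rho}$. Set $f=\varphi_\sigma^{-1}F$ and let $x\in\Lambda\cap I_j$ be a point with $\|f(x)\|_V=\|f\|_{\infty,\Lambda}$. Then for all positive integers $N$ and all words $\mathbf a\in W_N^j$, $$\big\|f(x)-\gamma_{\mathbf a}'(x)^{it}\rho(\gamma_{\mathbf a})^{-1}f(\gamma_{\mathbf a}(x))\big\|_V\le C^N\sqrt{\delta-\sigma}\;\|f\|_{\infty,\Lambda}.$$ -/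

import Mathlib

open Filter Topology MeasureTheory OnePoint
open scoped MatrixGroups

noncomputable section

/-- The Möbius transformation `z ↦ (az + b) / (cz + d)` of the complex plane (away from its pole). -/
def mobC (g : SL(2, ℝ)) (z : ℂ) : ℂ := (g 0 0 * z + g 0 1) / (g 1 0 * z + g 1 1)

/-- The Möbius transformation `x ↦ (ax + b) / (cx + d)` of the real line (away from its pole). -/
def mobR (g : SL(2, ℝ)) (x : ℝ) : ℝ := (g 0 0 * x + g 0 1) / (g 1 0 * x + g 1 1)

/-- The action of `SL(2, ℝ)` on the extended complex plane `ℂ ∪ {∞}` by Möbius transformations. -/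
def mobExt (g : SL(2, ℝ)) (z : OnePoint ℂ) : OnePoint ℂ :=
  ((Matrix.SpecialLinearGroup.map Complex.ofRealHom g : SL(2, ℂ)) : GL (Fin 2) ℂ) • z

/-- The quotient `f = φ⁻¹ F`, as a function of a real variable. -/
def quotientBy {V : Type*} [NormedAddCommGroup V] [InnerProductSpace ℂ V]
    (φ : ℝ → ℝ) (F : ℂ → V) (x : ℝ) : V := (((φ x)⁻¹ : ℝ) : ℂ) • F (x : ℂ)

/-- Schottky data with `2m` disks. The index set `[2m]` is written as `Fin m ⊕ Fin m`, where
`inl j` stands for `j` and `inr j` stands for `j + m`, so that `Sum.swap` is `j ↦ j + m` modulo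
`2m`. The disks have centers on the real line and do not intersect (nor touch), and the `j`-th
generator maps the exterior of the `j`-th disk in the extended complex plane onto the interior
of the disk with index `j + m`. -/
structure SchottkyData (m : ℕ) where
  center : Fin m ⊕ Fin m → ℝ
  radius : Fin m ⊕ Fin m → ℝ
  radius_pos : ∀ j, 0 < radius j
  disjoint : ∀ i j, i ≠ j →
    Disjoint (Metric.closedBall (center i : ℂ) (radius i))
      (Metric.closedBall (center j : ℂ) (radius j))
  gen : Fin m → SL(2, ℝ)
  gen_maps : ∀ j : Fin m,
    mobExt (gen j) '' ((fun z : ℂ => (z : OnePoint ℂ)) ''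
        Metric.closedBall (center (Sum.inl j) : ℂ) (radius (Sum.inl j)))ᶜ =
      (fun z : ℂ => (z : OnePoint ℂ)) ''
        Metric.ball (center (Sum.inr j) : ℂ) (radius (Sum.inr j))

namespace SchottkyData

variable {m : ℕ} (S : SchottkyData m)

/-- The generators `γ_1, …, γ_{2m}`, with `γ_{j+m} = γ_j⁻¹`. -/
def γ : Fin m ⊕ Fin m → SL(2, ℝ) := Sum.elim S.gen (fun j => (S.gen j)⁻¹)

/-- The (open) disk `D_j`. -/
def disk (j : Fin m ⊕ Fin m) : Set ℂ := Metric.ball (S.center j : ℂ) (S.radius j)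

/-- The union `D` of the disks. -/
def D : Set ℂ := ⋃ j, S.disk j

/-- The real interval `I_j = D_j ∩ ℝ`. -/
def interval (j : Fin m ⊕ Fin m) : Set ℝ := {x | (x : ℂ) ∈ S.disk j}

/-- The union `I` of the intervals. -/
def I : Set ℝ := ⋃ j, S.interval j

/-- The Schottky group `Γ`, generated by the `γ_j` inside `SL(2, ℝ)`. -/
def Γ : Subgroup SL(2, ℝ) := Subgroup.closure (Set.range S.γ)

/-- The generator `γ_j` as an element of `Γ`. -/
def genΓ (j : Fin m ⊕ Fin m) : S.Γ := ⟨S.γ j, Subgroup.subset_closure ⟨j, rfl⟩⟩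

/-- The limit set: the accumulation points of orbits of `Γ` in the hyperbolic plane that lie on
the real line (the point `∞` lies outside all closed disks and is never a limit point). -/
def Λ : Set ℝ :=
  {x | ∃ z : UpperHalfPlane,
    AccPt (x : ℂ) (𝓟 ((fun w : UpperHalfPlane => (w : ℂ)) '' {w | ∃ g ∈ S.Γ, w = g • z}))}

/-- The Hausdorff dimension of the limit set. -/
def δ : ℝ := (dimH S.Λ).toReal

/-- `γ_a = γ_{a_1} ∘ ⋯ ∘ γ_{a_N}`, as an element of `Γ`. -/
def word (a : List (Fin m ⊕ Fin m)) : S.Γ := (a.map S.genΓ).prod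

/-- `W_N^j`: the reduced words of length `N` whose last letter is not `j`. -/
def W (_S : SchottkyData m) (N : ℕ) (j : Fin m ⊕ Fin m) : Set (List (Fin m ⊕ Fin m)) :=
  {a | a.length = N ∧ a.IsChain (fun k l => k ≠ l.swap) ∧ a.getLast? ≠ Option.some j}

lemma disk_disjoint {i j : Fin m ⊕ Fin m} {z : ℂ} (hi : z ∈ S.disk i) (hj : z ∈ S.disk j) :
    i = j := by
  by_contra h
  exact Set.disjoint_left.1 (S.disjoint i j h) (Metric.ball_subset_closedBall hi)
    (Metric.ball_subset_closedBall hj)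

/-! ### Bowen–Series map and topological pressure -/

open Classical in
/-- The Bowen–Series map: `T x = γ_j x` if `x ∈ I_j`. The value `∞` is used (and kept by all
further iterates) when `x` is not in `I`, so that a real `x` with `T^N x = x` has its whole orbit
in `I`. -/
def bowenSeries (y : OnePoint ℝ) : OnePoint ℝ :=
  y.elim ∞ fun x =>
    if h : ∃ j, x ∈ S.interval j then ((S.γ h.choose : SL(2, ℝ)) : GL (Fin 2) ℝ) • (x : OnePoint ℝ)
    else ∞

lemma bowenSeries_of_mem {j : Fin m ⊕ Fin m} {x : ℝ} (hx : x ∈ S.interval j) :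
    S.bowenSeries x = ((S.γ j : SL(2, ℝ)) : GL (Fin 2) ℝ) • (x : OnePoint ℝ) := by
  have h : ∃ j, x ∈ S.interval j := ⟨j, hx⟩
  have e : h.choose = j := S.disk_disjoint h.choose_spec hx
  simp [bowenSeries, h, e]

/-- `|T'|` on `I`. -/
def absDerivT (x : ℝ) : ℝ :=
  ∑ j, (S.interval j).indicator (fun y => |deriv (mobR (S.γ j)) y|) x

/-- The topological pressure of `ψ : I → ℝ`,
`lim_N (1/N) log ∑_{T^N x = x} exp (ψ(x) + ψ(Tx) + ⋯ + ψ(T^{N-1} x))`. -/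
def pressure (ψ : ℝ → ℝ) : ℝ :=
  limUnder atTop fun N : ℕ => (1 / (N : ℝ)) * Real.log
    (∑ᶠ x ∈ {x : ℝ | S.bowenSeries^[N] (x : OnePoint ℝ) = x},
      Real.exp (birkhoffSum S.bowenSeries (fun y => y.elim 0 ψ) N (x : OnePoint ℝ)))

/-- `P(σ) = P(-σ log |T'|)`. -/
def P (σ : ℝ) : ℝ := S.pressure fun x => -σ * Real.log (S.absDerivT x)

/-! ### Transfer operators -/

/-- The untwisted transfer operator `ℒ_σ` on functions on `I`, for real `σ`:
`ℒ_σ φ (x) = ∑_{i ≠ j} γ_i'(x)^σ φ(γ_i x)` if `x ∈ I_j`. -/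
def transferReal (σ : ℝ) (φ : ℝ → ℝ) (x : ℝ) : ℝ :=
  ∑ j, (S.interval j).indicator
    (fun y => ∑ i ∈ Finset.univ.erase j,
      (deriv (mobR (S.γ i)) y) ^ σ * φ (mobR (S.γ i) y)) x

/-- `φ` is a strictly positive eigenfunction in `C¹(I)` of `ℒ_σ` for its maximal eigenvalue
`e^{P(σ)}`. By the Ruelle–Perron–Frobenius theorem such a `φ` exists, and for `m ≥ 2` it is
unique on `I` up to a positive factor; it is denoted `φ_σ`. -/
structure IsRPFEigenfunction (σ : ℝ) (φ : ℝ → ℝ) : Prop where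
  contDiffOn : ContDiffOn ℝ 1 φ S.I
  pos : ∀ x ∈ S.I, 0 < φ x
  eigen : ∀ x ∈ S.I, S.transferReal σ φ x = Real.exp (S.P σ) * φ x

section Twisted

variable {V : Type*} [NormedAddCommGroup V] [InnerProductSpace ℂ V]

/-- The twisted transfer operator
`ℒ_{s,ρ} F (z) = ∑_{i ≠ j} γ_i'(z)^s ρ(γ_i)⁻¹ F(γ_i z)` if `z ∈ D_j`. (On `D_j` with `j ≠ i`, the
function `γ_i'` is positive on the reals and avoids `(-∞, 0]`, so the principal power is the
holomorphic one.) -/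
def transfer (s : ℂ) (ρ : S.Γ →* (V ≃ₗᵢ[ℂ] V)) (F : ℂ → V) (z : ℂ) : V :=
  ∑ j, (S.disk j).indicator
    (fun w => ∑ i ∈ Finset.univ.erase j,
      (deriv (mobC (S.γ i)) w) ^ s • (ρ (S.genΓ i))⁻¹ (F (mobC (S.γ i) w))) z

lemma transfer_of_mem (s : ℂ) (ρ : S.Γ →* (V ≃ₗᵢ[ℂ] V)) (F : ℂ → V) {z : ℂ}
    {j : Fin m ⊕ Fin m} (hz : z ∈ S.disk j) :
    S.transfer s ρ F z = ∑ i ∈ Finset.univ.erase j,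
      (deriv (mobC (S.γ i)) z) ^ s • (ρ (S.genΓ i))⁻¹ (F (mobC (S.γ i) z)) := by
  unfold transfer
  rw [Finset.sum_eq_single j]
  · exact Set.indicator_of_mem hz _
  · intro i _ hij
    exact Set.indicator_of_notMem (fun hi => hij (S.disk_disjoint hi hz)) _
  · simp

/-- Membership in the Bergman space `H²(D, V)`: holomorphic and square-integrable on `D`. -/
structure MemBergman (F : ℂ → V) : Prop where
  holomorphic : DifferentiableOn ℂ F S.D
  square_integrable : IntegrableOn (fun z => ‖F z‖ ^ 2) S.D volume

/-- `F ∈ H²(D, V)` is a 1-eigenfunction of `ℒ_{s,ρ}`: it is not zero on `D` and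
`ℒ_{s,ρ} F = F` on `D`. -/
structure IsOneEigenfunction (s : ℂ) (ρ : S.Γ →* (V ≃ₗᵢ[ℂ] V)) (F : ℂ → V) : Prop where
  memBergman : S.MemBergman F
  ne_zero : ∃ z ∈ S.D, F z ≠ 0
  eigen : ∀ z ∈ S.D, S.transfer s ρ F z = F z

/-- The maximum norm on the limit set. -/
def supNorm (h : ℝ → V) : ℝ := ⨆ x : S.Λ, ‖h x‖

end Twisted

end SchottkyData

end

/-!
The functions `F` and `φ` are eigenfunctions, so `f = φ⁻¹ F` satisfies, for `x ∈ I_j`,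
`f x = ∑_a p_a u_a` (sum over `a ∈ W_N^j`), where `u_a = γ_a'(x)^{it} ρ(γ_a)⁻¹ f(γ_a x)` are the
vectors to be compared with `f x` and `p_a = γ_a'(x)^σ φ(γ_a x) / φ(x) > 0` have the sum `lam ^ N`,
`lam = e^{P(σ)}`. If `‖f‖` has its maximum over `Λ` at `x`, then `‖u_a‖ ≤ ‖f x‖` because `Λ` is
invariant, and expanding the squares gives `p_a ‖f x - u_a‖² ≤ 2 (lam ^ N - 1) ‖f x‖²`
(`mul_norm_sub_sq_le_of_eq_sum`). It remains to bound `p_a` from below and `lam` from above, with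
constants that depend on the Schottky data only.

The lower bound for `p_a` is a Harnack inequality (`harnack`, `le_apply_γ`): iterating the
eigenvalue equation, bounded distortion of the words (`exists_distortionBound`) shows that `φ`
varies on one interval by a bounded factor, and `γ_j⁻¹` leads back from `γ_i x` to the interval of
`x`.

The upper bound is `lam ≤ C ^ (δ - σ)` (`lam_le_rpow`), for any `C` with `γ_i' ≥ 1 / C`. It
contains one half of Bowen's formula, `P(δ) ≤ 0`, and comes from a mass distribution argument: if
`lam > C ^ (s - σ)` with `s > δ`, then the atoms `γ_a x` with the masses `p_a / lam ^ N` give a set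
of diameter `d` at most a mass `≲ d ^ s + o(1)`, so that the limit set cannot have vanishing
`s`-dimensional Hausdorff measure (`hausdorffMeasure_ne_zero_of_finite_mass`). Only the eigenvalue
equation of `φ` is used, and no existence statement for the limit that defines the pressure.

Words are processed from their last letter, which acts first, and are therefore stored in reversed
order. For real points, everything follows from the identity
`(g x - g y)² = g'(x) g'(y) (x - y)²` of Möbius transformations, the location of the poles of words,
and the contraction of the Hilbert metrics of the intervals.
-/

noncomputable section

/-! ### Real Möbius transformations -/

/-- The denominator `cx + d` of the Möbius transformation `g` at `x`. -/
def mobDen (g : SL(2, ℝ)) (x : ℝ) : ℝ := g 1 0 * x + g 1 1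

/-- The expression `(cx + d)⁻²`, which is the derivative of the Möbius transformation `g` at `x`
whenever `x` is not the pole. -/
def mobDeriv (g : SL(2, ℝ)) (x : ℝ) : ℝ := (mobDen g x ^ 2)⁻¹

lemma mobDeriv_nonneg (g : SL(2, ℝ)) (x : ℝ) : 0 ≤ mobDeriv g x := by
  unfold mobDeriv; positivity

lemma mobDeriv_pos {g : SL(2, ℝ)} {x : ℝ} (h : mobDen g x ≠ 0) : 0 < mobDeriv g x := by
  unfold mobDeriv; positivity

lemma SL2_det (g : SL(2, ℝ)) : g 0 0 * g 1 1 - g 0 1 * g 1 0 = 1 := by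
  have := g.det_coe
  rwa [Matrix.det_fin_two] at this

lemma mobDen_one (x : ℝ) : mobDen 1 x = 1 := by simp [mobDen]

lemma mobDeriv_one (x : ℝ) : mobDeriv 1 x = 1 := by simp [mobDeriv, mobDen_one]

lemma mobR_one (x : ℝ) : mobR 1 x = x := by simp [mobR]

lemma mobDen_mul (g h : SL(2, ℝ)) {x : ℝ} (hx : mobDen h x ≠ 0) :
    mobDen (g * h) x = mobDen g (mobR h x) * mobDen h x := by
  have h2 : h 1 0 * x + h 1 1 ≠ 0 := hx
  simp only [mobDen, mobR, Matrix.SpecialLinearGroup.coe_mul, Matrix.mul_apply, Fin.sum_univ_two]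
  field_simp
  ring

lemma mobR_mul (g h : SL(2, ℝ)) {x : ℝ} (hx : mobDen h x ≠ 0) :
    mobR (g * h) x = mobR g (mobR h x) := by
  have h2 : h 1 0 * x + h 1 1 ≠ 0 := hx
  have h3 := mobDen_mul g h hx
  have h4 : mobR (g * h) x = ((g * h) 0 0 * x + (g * h) 0 1) / mobDen (g * h) x := rfl
  have h5 : (g * h) 0 0 * x + (g * h) 0 1 = (g 0 0 * mobR h x + g 0 1) * mobDen h x := by
    simp only [mobDen, mobR, Matrix.SpecialLinearGroup.coe_mul, Matrix.mul_apply, Fin.sum_univ_two]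
    field_simp
    ring
  rw [h4, h3, h5, mul_div_mul_right _ _ hx]
  rfl

lemma mobDeriv_mul (g h : SL(2, ℝ)) {x : ℝ} (hx : mobDen h x ≠ 0) :
    mobDeriv (g * h) x = mobDeriv h x * mobDeriv g (mobR h x) := by
  unfold mobDeriv
  rw [mobDen_mul g h hx, mul_pow, mul_inv, mul_comm]

lemma mobR_sub (g : SL(2, ℝ)) {x y : ℝ} (hx : mobDen g x ≠ 0) (hy : mobDen g y ≠ 0) :
    mobR g x - mobR g y = (x - y) / (mobDen g x * mobDen g y) := by
  have h1 := SL2_det g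
  unfold mobR
  change (g 0 0 * x + g 0 1) / mobDen g x - (g 0 0 * y + g 0 1) / mobDen g y = _
  rw [div_sub_div _ _ hx hy]
  congr 1
  unfold mobDen
  linear_combination (x - y) * h1

/-- The conformal distance identity `(g x - g y)² = g'(x) g'(y) (x - y)²`. -/
lemma mobR_sub_sq (g : SL(2, ℝ)) {x y : ℝ} (hx : mobDen g x ≠ 0) (hy : mobDen g y ≠ 0) :
    (mobR g x - mobR g y) ^ 2 = mobDeriv g x * mobDeriv g y * (x - y) ^ 2 := by
  rw [mobR_sub g hx hy]
  unfold mobDeriv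
  field_simp

lemma mobDen_continuous (g : SL(2, ℝ)) : Continuous (mobDen g) := by
  unfold mobDen; fun_prop

lemma mobR_continuousAt (g : SL(2, ℝ)) {x : ℝ} (hx : mobDen g x ≠ 0) :
    ContinuousAt (mobR g) x := by
  unfold mobR
  exact ContinuousAt.div (by fun_prop) (by fun_prop) hx

lemma deriv_mobR (g : SL(2, ℝ)) {x : ℝ} (hx : mobDen g x ≠ 0) :
    deriv (mobR g) x = mobDeriv g x := by
  have h1 := SL2_det g
  have hn : HasDerivAt (fun y : ℝ => g 0 0 * y + g 0 1) (g 0 0) x := by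
    simpa using ((hasDerivAt_id x).const_mul (g 0 0)).add_const (g 0 1)
  have hd : HasDerivAt (fun y : ℝ => g 1 0 * y + g 1 1) (g 1 0) x := by
    simpa using ((hasDerivAt_id x).const_mul (g 1 0)).add_const (g 1 1)
  have h := (hn.fun_div hd hx).deriv
  refine h.trans ?_
  unfold mobDeriv mobDen
  rw [inv_eq_one_div]
  congr 1
  linear_combination h1

lemma mobC_ofReal (g : SL(2, ℝ)) (x : ℝ) : mobC g x = (mobR g x : ℂ) := by
  simp [mobC, mobR]

lemma mobDenC_ofReal (g : SL(2, ℝ)) (x : ℝ) :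
    (g 1 0 : ℂ) * x + g 1 1 = ((mobDen g x : ℝ) : ℂ) := by
  simp [mobDen]

lemma deriv_mobC (g : SL(2, ℝ)) {x : ℝ} (hx : mobDen g x ≠ 0) :
    deriv (mobC g) x = ((mobDeriv g x : ℝ) : ℂ) := by
  have h1 : (g 0 0 : ℂ) * g 1 1 - g 0 1 * g 1 0 = 1 := by exact_mod_cast SL2_det g
  have hx' : (g 1 0 : ℂ) * x + g 1 1 ≠ 0 := by
    rw [mobDenC_ofReal]; exact_mod_cast hx
  have hn : HasDerivAt (fun y : ℂ => (g 0 0 : ℂ) * y + g 0 1) (g 0 0) x := by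
    simpa using ((hasDerivAt_id (x : ℂ)).const_mul (g 0 0 : ℂ)).add_const (g 0 1 : ℂ)
  have hd : HasDerivAt (fun y : ℂ => (g 1 0 : ℂ) * y + g 1 1) (g 1 0) x := by
    simpa using ((hasDerivAt_id (x : ℂ)).const_mul (g 1 0 : ℂ)).add_const (g 1 1 : ℂ)
  have h := (hn.fun_div hd hx').deriv
  refine h.trans ?_
  rw [mobDenC_ofReal]
  unfold mobDeriv
  push_cast
  rw [inv_eq_one_div]
  congr 1
  rw [← mobDenC_ofReal]
  linear_combination h1

lemma mobExt_ofReal (g : SL(2, ℝ)) (x : ℝ) :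
    mobExt g ((x : ℂ) : OnePoint ℂ) =
      if mobDen g x = 0 then ∞ else ((mobR g x : ℂ) : OnePoint ℂ) := by
  unfold mobExt
  rw [OnePoint.smul_some_eq_ite]
  simp only [Matrix.SpecialLinearGroup.coe_GL_coe_matrix, Matrix.SpecialLinearGroup.map_apply_coe,
    RingHom.mapMatrix_apply, Matrix.map_apply, Complex.ofRealHom_eq_coe, mobDenC_ofReal]
  rw [← mobC_ofReal]
  simp [mobC, mobDenC_ofReal]

lemma mobExt_infty (g : SL(2, ℝ)) (h : g 1 0 = 0) : mobExt g ∞ = ∞ := by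
  unfold mobExt
  rw [OnePoint.smul_infty_eq_ite]
  simp [h]

lemma mobExt_inv (g : SL(2, ℝ)) (z : OnePoint ℂ) : mobExt g (mobExt g⁻¹ z) = z := by
  unfold mobExt
  rw [smul_smul]
  simp

namespace SchottkyData

variable {m : ℕ} (S : SchottkyData m)

/-! ### The geometry of the generators -/

lemma mem_interval {k : Fin m ⊕ Fin m} {x : ℝ} :
    x ∈ S.interval k ↔ |x - S.center k| < S.radius k := by
  simp only [interval, disk, Set.mem_ofPred_eq, Metric.mem_ball]
  rw [Complex.dist_eq, ← Complex.ofReal_sub, Complex.norm_real, Real.norm_eq_abs]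

lemma mem_closedBall_iff {k : Fin m ⊕ Fin m} {x : ℝ} :
    (x : ℂ) ∈ Metric.closedBall (S.center k : ℂ) (S.radius k) ↔ |x - S.center k| ≤ S.radius k := by
  rw [Metric.mem_closedBall, Complex.dist_eq, ← Complex.ofReal_sub, Complex.norm_real,
    Real.norm_eq_abs]

lemma gen_entry_ne_zero (j : Fin m) : S.gen j 1 0 ≠ 0 := by
  intro h
  have : mobExt (S.gen j) ∞ ∈ mobExt (S.gen j) '' ((fun z : ℂ => (z : OnePoint ℂ)) ''
        Metric.closedBall (S.center (Sum.inl j) : ℂ) (S.radius (Sum.inl j)))ᶜ :=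
    ⟨∞, by simp, rfl⟩
  rw [S.gen_maps j, mobExt_infty _ h] at this
  simp at this

lemma γ_entry_ne_zero (i : Fin m ⊕ Fin m) : S.γ i 1 0 ≠ 0 := by
  rcases i with j | j
  · exact S.gen_entry_ne_zero j
  · change ((S.gen j)⁻¹ : SL(2, ℝ)) 1 0 ≠ 0
    rw [Matrix.SpecialLinearGroup.SL2_inv_expl]
    simpa using S.gen_entry_ne_zero j

lemma γ_swap (i : Fin m ⊕ Fin m) : S.γ i.swap = (S.γ i)⁻¹ := by
  rcases i with j | j <;> simp [γ]

/-- Outside its closed disk a generator has no pole; its values are only located in the closed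
target disk here. -/
lemma γ_maps_weak (i : Fin m ⊕ Fin m) {x : ℝ} (hx : S.radius i < |x - S.center i|) :
    mobDen (S.γ i) x ≠ 0 ∧ |mobR (S.γ i) x - S.center i.swap| ≤ S.radius i.swap := by
  have hx' : (x : ℂ) ∉ Metric.closedBall (S.center i : ℂ) (S.radius i) := by
    rw [mem_closedBall_iff]; exact not_le.2 hx
  rcases i with j | j
  · have : mobExt (S.gen j) ((x : ℂ) : OnePoint ℂ) ∈ mobExt (S.gen j) ''
        ((fun z : ℂ => (z : OnePoint ℂ)) ''
        Metric.closedBall (S.center (Sum.inl j) : ℂ) (S.radius (Sum.inl j)))ᶜ :=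
      ⟨_, by simpa using hx', rfl⟩
    rw [S.gen_maps j, mobExt_ofReal] at this
    change mobDen (S.gen j) x ≠ 0 ∧ _
    split_ifs at this with h
    · simp at this
    · refine ⟨h, S.mem_closedBall_iff.1 (Metric.ball_subset_closedBall ?_)⟩
      change ((mobR (S.gen j) x : ℝ) : ℂ) ∈ _
      simpa using this
  · by_contra hcon
    have hout : mobExt (S.gen j)⁻¹ ((x : ℂ) : OnePoint ℂ) ∈ ((fun z : ℂ => (z : OnePoint ℂ)) ''
        Metric.closedBall (S.center (Sum.inl j) : ℂ) (S.radius (Sum.inl j)))ᶜ := by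
      rintro ⟨z, hz, hz'⟩
      rw [mobExt_ofReal] at hz'
      split_ifs at hz' with h
      · simp at hz'
      · refine hcon ⟨h, S.mem_closedBall_iff.1 ?_⟩
        have : z = ((mobR (S.gen j)⁻¹ x : ℝ) : ℂ) := by simpa using hz'
        change ((mobR (S.gen j)⁻¹ x : ℝ) : ℂ) ∈ _
        rw [← this]; exact hz
    have h2 := Set.mem_image_of_mem (mobExt (S.gen j)) hout
    rw [S.gen_maps j, mobExt_inv] at h2
    exact hx' (Metric.ball_subset_closedBall (by simpa using h2))

lemma γ_maps (i : Fin m ⊕ Fin m) {x : ℝ} (hx : S.radius i < |x - S.center i|) :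
    mobDen (S.γ i) x ≠ 0 ∧ mobR (S.γ i) x ∈ S.interval i.swap := by
  have h0 := (S.γ_maps_weak i hx).1
  refine ⟨h0, S.mem_interval.2 ?_⟩
  -- `γ_i` is strictly increasing near `x`, so an extremal value at `x` would be exceeded nearby.
  have hev : ∀ᶠ y in 𝓝 x, S.radius i < |y - S.center i| ∧ 0 < mobDen (S.γ i) y * mobDen (S.γ i) x :=
    (ContinuousAt.eventually_lt (by fun_prop) (by fun_prop) hx).and
      (ContinuousAt.eventually_lt (by fun_prop)
        ((mobDen_continuous _).continuousAt.mul continuousAt_const) (mul_self_pos.2 h0))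
  obtain ⟨ε, hε, h⟩ := Metric.eventually_nhds_iff.1 hev
  have key : ∀ y, |y - x| < ε → |mobR (S.γ i) y - S.center i.swap| ≤ S.radius i.swap ∧
      mobR (S.γ i) y - mobR (S.γ i) x = (y - x) / (mobDen (S.γ i) y * mobDen (S.γ i) x) ∧
      0 < mobDen (S.γ i) y * mobDen (S.γ i) x := by
    intro y hy
    obtain ⟨h1, h2⟩ := h (show dist y x < ε by rwa [Real.dist_eq])
    have h3 := S.γ_maps_weak i h1
    exact ⟨h3.2, mobR_sub _ h3.1 h0, h2⟩
  obtain ⟨a1, a2, a3⟩ := key (x + ε / 2) (by rw [abs_lt]; constructor <;> linarith)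
  obtain ⟨b1, b2, b3⟩ := key (x - ε / 2) (by rw [abs_lt]; constructor <;> linarith)
  have a4 : 0 < mobR (S.γ i) (x + ε / 2) - mobR (S.γ i) x := by
    rw [a2]; exact div_pos (by linarith) a3
  have b4 : mobR (S.γ i) (x - ε / 2) - mobR (S.γ i) x < 0 := by
    rw [b2]; exact div_neg_of_neg_of_pos (by linarith) b3
  rw [abs_le] at a1 b1
  rw [abs_lt]
  constructor <;> linarith

/-- Points of different closed intervals are separated: a closed interval lies in the exterior of
every other closed disk. -/
lemma radius_lt_of_ne {i k : Fin m ⊕ Fin m} (h : k ≠ i) {x : ℝ}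
    (hx : |x - S.center k| ≤ S.radius k) : S.radius i < |x - S.center i| := by
  by_contra hcon
  exact Set.disjoint_left.1 (S.disjoint k i h) (S.mem_closedBall_iff.2 hx)
    (S.mem_closedBall_iff.2 (not_lt.1 hcon))

/-- The pole of `γ_i` lies in the closed interval `I_i`. -/
lemma exists_pole (i : Fin m ⊕ Fin m) :
    ∃ p, |p - S.center i| ≤ S.radius i ∧ mobDen (S.γ i) p = 0 := by
  refine ⟨-(S.γ i 1 1) / S.γ i 1 0, ?_, ?_⟩
  · by_contra hcon
    refine (S.γ_maps_weak i (not_le.1 hcon)).1 ?_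
    have := S.γ_entry_ne_zero i
    unfold mobDen; field_simp; ring
  · have := S.γ_entry_ne_zero i
    unfold mobDen; field_simp; ring

lemma γ_maps_interval {i k : Fin m ⊕ Fin m} (h : i ≠ k) {x : ℝ} (hx : x ∈ S.interval k) :
    mobDen (S.γ i) x ≠ 0 ∧ mobR (S.γ i) x ∈ S.interval i.swap :=
  S.γ_maps i (S.radius_lt_of_ne h.symm (S.mem_interval.1 hx).le)

/-! ### Uniform constants -/

lemma exists_gap : ∃ g > 0, ∀ i k : Fin m ⊕ Fin m, i ≠ k → ∀ x y : ℝ,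
    |x - S.center i| ≤ S.radius i → |y - S.center k| ≤ S.radius k → g ≤ |x - y| := by
  have h : ∀ᶠ g in 𝓝[>] (0 : ℝ), ∀ p : (Fin m ⊕ Fin m) × (Fin m ⊕ Fin m), p.1 ≠ p.2 →
      g ≤ |S.center p.1 - S.center p.2| - S.radius p.1 - S.radius p.2 := by
    rw [eventually_all]
    rintro ⟨i, k⟩
    by_cases hik : i = k
    · simp [hik]
    · have h1 := (disjoint_closedBall_closedBall_iff (S.radius_pos i).le (S.radius_pos k).le).1
        (S.disjoint i k hik)
      rw [Complex.dist_eq, ← Complex.ofReal_sub, Complex.norm_real, Real.norm_eq_abs] at h1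
      have h2 : 0 < |S.center i - S.center k| - S.radius i - S.radius k := by linarith
      filter_upwards [Ioo_mem_nhdsGT h2] with g hg _
      exact hg.2.le
  obtain ⟨g, hg, hg0⟩ := (h.and self_mem_nhdsWithin).exists
  refine ⟨g, hg0, fun i k hik x y hx hy => (hg (i, k) hik).trans ?_⟩
  have e : S.center i - S.center k = (x - y) + ((y - S.center k) - (x - S.center i)) := by ring
  have := abs_add_le (x - y) ((y - S.center k) - (x - S.center i))
  have := abs_sub (y - S.center k) (x - S.center i)
  simp only
  rw [e]
  linarith

lemma exists_bound : ∃ R ≥ 1, ∀ (k : Fin m ⊕ Fin m) (x : ℝ),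
    |x - S.center k| ≤ S.radius k → |x| ≤ R := by
  have h : ∀ᶠ R in atTop, ∀ k : Fin m ⊕ Fin m, |S.center k| + S.radius k ≤ R := by
    rw [eventually_all]
    exact fun k => eventually_ge_atTop _
  obtain ⟨R, hR, h1⟩ := (h.and (eventually_ge_atTop (1 : ℝ))).exists
  refine ⟨R, h1, fun k x hx => le_trans ?_ (hR k)⟩
  have := abs_add_le (x - S.center k) (S.center k)
  rw [sub_add_cancel] at this
  linarith

/-- `C ≥ 1`, and `γ_i' ≥ 1 / C` on the intervals `I_k` with `k ≠ i`. -/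
def IsExpansionBound (C : ℝ) : Prop :=
  1 ≤ C ∧ ∀ i k : Fin m ⊕ Fin m, i ≠ k → ∀ x ∈ S.interval k, 1 ≤ C * mobDeriv (S.γ i) x

lemma exists_expansionBound : ∃ C, S.IsExpansionBound C := by
  obtain ⟨R, hR1, hR⟩ := S.exists_bound
  have h : ∀ᶠ C in atTop, ∀ i : Fin m ⊕ Fin m, (|S.γ i 1 0| * R + |S.γ i 1 1|) ^ 2 ≤ C := by
    rw [eventually_all]
    exact fun k => eventually_ge_atTop _
  obtain ⟨C, hC, h1⟩ := (h.and (eventually_ge_atTop (1 : ℝ))).exists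
  refine ⟨C, h1, fun i k hik x hx => ?_⟩
  have h0 := (S.γ_maps_interval hik hx).1
  have h2 : |mobDen (S.γ i) x| ≤ |S.γ i 1 0| * R + |S.γ i 1 1| := by
    refine (abs_add_le _ _).trans ?_
    rw [abs_mul]
    gcongr
    exact hR k x (S.mem_interval.1 hx).le
  have h3 : mobDen (S.γ i) x ^ 2 ≤ C := by
    rw [← sq_abs]
    exact (pow_le_pow_left₀ (abs_nonneg _) h2 2).trans (hC i)
  unfold mobDeriv
  rw [← div_eq_mul_inv, one_le_div (by positivity)]
  exact h3

/-- The images `γ_i(I_k)`, `i ≠ k`, of the closed intervals stay at a definite distance from the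
end points of the interval in which they lie. -/
lemma exists_margin : ∃ η > 0, ∀ i k : Fin m ⊕ Fin m, i ≠ k → ∀ x : ℝ,
    |x - S.center k| ≤ S.radius k →
      |mobR (S.γ i) x - S.center i.swap| ≤ S.radius i.swap - η := by
  have h : ∀ᶠ η in 𝓝[>] (0 : ℝ), ∀ p : (Fin m ⊕ Fin m) × (Fin m ⊕ Fin m), p.1 ≠ p.2 → ∀ x : ℝ,
    |x - S.center p.2| ≤ S.radius p.2 →
      |mobR (S.γ p.1) x - S.center p.1.swap| ≤ S.radius p.1.swap - η := by
    rw [eventually_all]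
    rintro ⟨i, k⟩
    by_cases hik : i = k
    · simp [hik]
    have hc : ContinuousOn (fun x => |mobR (S.γ i) x - S.center i.swap|)
        (Metric.closedBall (S.center k) (S.radius k)) := by
      intro x hx
      rw [Metric.mem_closedBall, Real.dist_eq] at hx
      have h0 := (S.γ_maps i (S.radius_lt_of_ne (Ne.symm hik) hx)).1
      have := mobR_continuousAt _ h0
      exact ContinuousAt.continuousWithinAt (by fun_prop)
    obtain ⟨x₀, hx₀, hmax⟩ := (isCompact_closedBall (S.center k) (S.radius k)).exists_isMaxOn
      ⟨S.center k, Metric.mem_closedBall_self (S.radius_pos k).le⟩ hc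
    rw [Metric.mem_closedBall, Real.dist_eq] at hx₀
    have h1 := S.mem_interval.1 (S.γ_maps i (S.radius_lt_of_ne (Ne.symm hik) hx₀)).2
    filter_upwards [Ioo_mem_nhdsGT (sub_pos.2 h1)] with η hη _ x hx
    have := hmax (show x ∈ Metric.closedBall _ _ by rwa [Metric.mem_closedBall, Real.dist_eq])
    have h3 := hη.2
    simp only [Set.mem_ofPred_eq] at this
    linarith
  obtain ⟨η, hη, hη0⟩ := (h.and self_mem_nhdsWithin).exists
  exact ⟨η, hη0, fun i k hik x hx => hη (i, k) hik x hx⟩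

/-! ### Contraction in the Hilbert metric of the intervals -/

/-- The density of the Hilbert metric (the real trace of the hyperbolic metric of `D_k`) on the
interval `I_k`. -/
def hilbertDensity (k : Fin m ⊕ Fin m) (x : ℝ) : ℝ :=
  1 / (x - (S.center k - S.radius k)) + 1 / (S.center k + S.radius k - x)

lemma mobDen_mul_pos {i k : Fin m ⊕ Fin m} (h : i ≠ k) {x y : ℝ}
    (hx : |x - S.center k| ≤ S.radius k) (hy : |y - S.center k| ≤ S.radius k) :
    0 < mobDen (S.γ i) x * mobDen (S.γ i) y := by
  obtain ⟨p, hp, hp0⟩ := S.exists_pole i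
  have hc := S.γ_entry_ne_zero i
  have e : ∀ z, mobDen (S.γ i) z = S.γ i 1 0 * (z - p) := by
    intro z; unfold mobDen at *; linear_combination hp0
  rw [e, e]
  have hpk := S.radius_lt_of_ne h hp
  have : 0 < (x - p) * (y - p) := by
    rw [abs_le] at hx hy
    rcases lt_abs.1 hpk with h1 | h1
    · exact mul_pos_of_neg_of_neg (by linarith) (by linarith)
    · exact mul_pos (by linarith) (by linarith)
  calc 0 < (S.γ i 1 0) ^ 2 * ((x - p) * (y - p)) := by positivity
    _ = _ := by ring

/-- The generators strictly contract the Hilbert metrics, by a uniform factor `q < 1`. -/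
lemma exists_contraction : ∃ q : ℝ, 0 ≤ q ∧ q < 1 ∧ ∀ i k : Fin m ⊕ Fin m, i ≠ k →
    ∀ x ∈ S.interval k, mobDeriv (S.γ i) x * S.hilbertDensity i.swap (mobR (S.γ i) x) ≤
      q * S.hilbertDensity k x := by
  obtain ⟨η, hη0, hη⟩ := S.exists_margin
  obtain ⟨R, hR1, hR⟩ := S.exists_bound
  have hmin : 0 < min η R := lt_min hη0 (by linarith)
  refine ⟨1 - min η R / (2 * R), ?_, ?_, ?_⟩
  · have : min η R / (2 * R) ≤ 1 := by
      rw [div_le_one (by linarith)]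
      have := min_le_right η R
      linarith
    linarith
  · have : 0 < min η R / (2 * R) := by positivity
    linarith
  intro i k hik x hx
  have hx' := S.mem_interval.1 hx
  have hr := S.radius_pos k
  set α := S.center k - S.radius k with hα
  set β := S.center k + S.radius k with hβ
  have hαk : |α - S.center k| ≤ S.radius k := by rw [abs_le]; constructor <;> linarith
  have hβk : |β - S.center k| ≤ S.radius k := by rw [abs_le]; constructor <;> linarith
  have hDα := S.mobDen_mul_pos hik hx'.le hαk
  have hDβ := S.mobDen_mul_pos hik hx'.le hβk
  have h0 := (S.γ_maps_interval hik hx).1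
  have h0α := right_ne_zero_of_mul hDα.ne'
  have h0β := right_ne_zero_of_mul hDβ.ne'
  have hα' := hη i k hik α hαk
  have hβ' := hη i k hik β hβk
  have hxy := S.mem_interval.1 (S.γ_maps_interval hik hx).2
  have e1 := mobR_sub (S.γ i) h0 h0α
  have e2 := mobR_sub (S.γ i) h0β h0
  have hl1 := hR i.swap (S.center i.swap + S.radius i.swap)
    (by simp [abs_of_pos (S.radius_pos i.swap)])
  have hl2 := hR i.swap (S.center i.swap - S.radius i.swap)
    (by simp [abs_of_pos (S.radius_pos i.swap)])
  unfold hilbertDensity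
  rw [← hα, ← hβ]
  set l := i.swap
  set y := mobR (S.γ i) x
  set D := mobDen (S.γ i) x
  set Da := mobDen (S.γ i) α with hDa
  set Db := mobDen (S.γ i) β with hDb
  rw [abs_lt] at hx' hxy
  rw [abs_le] at hα' hβ' hl1 hl2
  have p1 : 0 < x - α := by linarith
  have p2 : 0 < β - x := by linarith
  have hy1 : 0 < y - mobR (S.γ i) α := by rw [e1]; exact div_pos p1 hDα
  have hy2 : 0 < mobR (S.γ i) β - y := by rw [e2]; exact div_pos p2 (by linarith)
  have hq : ∀ u, 0 ≤ u → u ≤ 2 * R → u - η ≤ (1 - min η R / (2 * R)) * u := by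
    intro u hu hu2
    have : min η R / (2 * R) * u ≤ min η R := by
      rw [div_mul_eq_mul_div, div_le_iff₀ (by linarith)]
      exact mul_le_mul_of_nonneg_left hu2 hmin.le
    have := min_le_left η R
    nlinarith
  set q := 1 - min η R / (2 * R)
  have q1 : y - mobR (S.γ i) α ≤ q * (y - (S.center l - S.radius l)) :=
    le_trans (by linarith) (hq _ (by linarith) (by linarith))
  have q2 : mobR (S.γ i) β - y ≤ q * (S.center l + S.radius l - y) :=
    le_trans (by linarith) (hq _ (by linarith) (by linarith))
  have r1 : 1 / (y - (S.center l - S.radius l)) ≤ q * (1 / (y - mobR (S.γ i) α)) := by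
    rw [mul_one_div, div_le_div_iff₀ (by linarith) hy1]; linarith
  have r2 : 1 / (S.center l + S.radius l - y) ≤ q * (1 / (mobR (S.γ i) β - y)) := by
    rw [mul_one_div, div_le_div_iff₀ (by linarith) hy2]; linarith
  -- `γ_i` is an isometry onto its image interval `[γ_i α, γ_i β]`, whose density is larger than
  -- that of the surrounding interval by at least the factor `1 / q`.
  calc mobDeriv (S.γ i) x * (1 / (y - (S.center l - S.radius l)) +
          1 / (S.center l + S.radius l - y))
      ≤ mobDeriv (S.γ i) x * (q * (1 / (y - mobR (S.γ i) α)) +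
          q * (1 / (mobR (S.γ i) β - y))) :=
        mul_le_mul_of_nonneg_left (add_le_add r1 r2) (mobDeriv_nonneg _ _)
    _ = q * (1 / (x - α) + 1 / (β - x)) := by
        rw [e1, e2]
        unfold mobDeriv
        change (D ^ 2)⁻¹ * _ = _
        have hlin : Da * (β - x) + Db * (x - α) = (β - α) * D := by
          simp only [hDa, hDb, D, mobDen]; ring
        field_simp
        linear_combination q * hlin

/-! ### Reduced words, read backwards -/

/-- The Möbius transformation `γ_{a_1} ∘ ⋯ ∘ γ_{a_N}` of the word `a`, given by the reversed word
`r = a_N ⋯ a_1`; thus the head of `r` acts first. -/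
def rev (r : List (Fin m ⊕ Fin m)) : S.Γ := S.word r.reverse

lemma rev_nil : S.rev [] = 1 := rfl

lemma rev_cons (i : Fin m ⊕ Fin m) (r : List (Fin m ⊕ Fin m)) :
    S.rev (i :: r) = S.rev r * S.genΓ i := by
  simp [rev, word]

lemma coe_rev_cons (i : Fin m ⊕ Fin m) (r : List (Fin m ⊕ Fin m)) :
    (S.rev (i :: r) : SL(2, ℝ)) = S.rev r * S.γ i := by
  rw [rev_cons]; rfl

lemma rev_append (c b : List (Fin m ⊕ Fin m)) : S.rev (c ++ b) = S.rev b * S.rev c := by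
  simp [rev, word]

/-- The reversed word `r` can be applied to the points of `I_j`: it is reduced and its head is
not `j`. -/
def Adm : Fin m ⊕ Fin m → List (Fin m ⊕ Fin m) → Prop
  | _, [] => True
  | j, i :: r => i ≠ j ∧ Adm i.swap r

/-- The index of the interval into which the reversed word maps `I_j`. -/
def target : Fin m ⊕ Fin m → List (Fin m ⊕ Fin m) → Fin m ⊕ Fin m
  | j, [] => j
  | _, i :: r => target i.swap r

lemma Adm_append {j : Fin m ⊕ Fin m} {c b : List (Fin m ⊕ Fin m)} :
    Adm j (c ++ b) ↔ Adm j c ∧ Adm (target j c) b := by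
  induction c generalizing j with
  | nil => simp [Adm, target]
  | cons i c ih => simp [Adm, target, ih, and_assoc]

lemma target_append {j : Fin m ⊕ Fin m} {c b : List (Fin m ⊕ Fin m)} :
    target j (c ++ b) = target (target j c) b := by
  induction c generalizing j with
  | nil => rfl
  | cons i c ih => simp [target, ih]

lemma Adm_iff_isChain {j : Fin m ⊕ Fin m} {r : List (Fin m ⊕ Fin m)} :
    Adm j r ↔ r.head? ≠ Option.some j ∧ r.IsChain (fun k l => l ≠ k.swap) := by
  induction r generalizing j with
  | nil => simp [Adm]
  | cons i r ih =>
    rw [Adm, ih]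
    cases r with
    | nil => simp
    | cons l r => simp

lemma adm_reverse_of_mem_W {N : ℕ} {j : Fin m ⊕ Fin m} {a : List (Fin m ⊕ Fin m)}
    (ha : a ∈ S.W N j) : Adm j a.reverse := by
  obtain ⟨-, h1, h2⟩ := ha
  rw [Adm_iff_isChain]
  refine ⟨by simpa using h2, ?_⟩
  rw [List.isChain_reverse]
  exact h1

/-- The reversed words of length `n` that can be applied to the points of `I_j`. -/
def words : ℕ → Fin m ⊕ Fin m → Finset (List (Fin m ⊕ Fin m))
  | 0, _ => {[]}
  | n + 1, j => (Finset.univ.erase j).biUnion fun i => (words n i.swap).image (List.cons i)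

lemma mem_words {n : ℕ} {j : Fin m ⊕ Fin m} {r : List (Fin m ⊕ Fin m)} :
    r ∈ words n j ↔ r.length = n ∧ Adm j r := by
  induction n generalizing j r with
  | zero => cases r <;> simp [words, Adm]
  | succ n ih =>
    cases r with
    | nil => simp [words]
    | cons i r =>
      simp [words, Adm, ih]
      tauto

lemma sum_words_succ {E : Type*} [AddCommMonoid E] (n : ℕ) (j : Fin m ⊕ Fin m)
    (f : List (Fin m ⊕ Fin m) → E) :
    ∑ r ∈ words (n + 1) j, f r = ∑ i ∈ Finset.univ.erase j, ∑ r ∈ words n i.swap, f (i :: r) := by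
  rw [words, Finset.sum_biUnion]
  · refine Finset.sum_congr rfl fun i _ => ?_
    rw [Finset.sum_image]
    intro a _ b _ h
    simpa using h
  · intro i _ k _ hik
    rw [Function.onFun, Finset.disjoint_left]
    intro r hr hr'
    obtain ⟨a, -, rfl⟩ := Finset.mem_image.1 hr
    obtain ⟨b, -, hb⟩ := Finset.mem_image.1 hr'
    exact hik (by simpa using (congrArg List.head? hb).symm)

variable {S}

lemma rev_maps {j : Fin m ⊕ Fin m} {r : List (Fin m ⊕ Fin m)} (hr : Adm j r) {x : ℝ}
    (hx : x ∈ S.interval j) :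
    mobDen (S.rev r : SL(2, ℝ)) x ≠ 0 ∧ mobR (S.rev r : SL(2, ℝ)) x ∈ S.interval (target j r) := by
  induction r generalizing j x with
  | nil => simpa [rev_nil, mobDen_one, mobR_one, target] using hx
  | cons i r ih =>
    obtain ⟨h0, h1⟩ := S.γ_maps_interval hr.1 hx
    obtain ⟨h2, h3⟩ := ih hr.2 h1
    rw [coe_rev_cons, mobDen_mul _ _ h0, mobR_mul _ _ h0]
    exact ⟨mul_ne_zero h2 h0, h3⟩

lemma mobR_rev_cons {i j : Fin m ⊕ Fin m} (hij : i ≠ j) (r : List (Fin m ⊕ Fin m)) {x : ℝ}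
    (hx : x ∈ S.interval j) :
    mobR (S.rev (i :: r) : SL(2, ℝ)) x = mobR (S.rev r : SL(2, ℝ)) (mobR (S.γ i) x) := by
  rw [coe_rev_cons, mobR_mul _ _ (S.γ_maps_interval hij hx).1]

lemma mobDeriv_rev_cons {i j : Fin m ⊕ Fin m} (hij : i ≠ j) (r : List (Fin m ⊕ Fin m)) {x : ℝ}
    (hx : x ∈ S.interval j) :
    mobDeriv (S.rev (i :: r) : SL(2, ℝ)) x =
      mobDeriv (S.γ i) x * mobDeriv (S.rev r : SL(2, ℝ)) (mobR (S.γ i) x) := by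
  rw [coe_rev_cons, mobDeriv_mul _ _ (S.γ_maps_interval hij hx).1]

lemma mobR_rev_append {j : Fin m ⊕ Fin m} {c : List (Fin m ⊕ Fin m)} (hc : Adm j c)
    (b : List (Fin m ⊕ Fin m)) {x : ℝ} (hx : x ∈ S.interval j) :
    mobR (S.rev (c ++ b) : SL(2, ℝ)) x =
      mobR (S.rev b : SL(2, ℝ)) (mobR (S.rev c : SL(2, ℝ)) x) := by
  rw [rev_append, Subgroup.coe_mul, mobR_mul _ _ (rev_maps hc hx).1]

lemma mobDeriv_rev_append {j : Fin m ⊕ Fin m} {c : List (Fin m ⊕ Fin m)} (hc : Adm j c)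
    (b : List (Fin m ⊕ Fin m)) {x : ℝ} (hx : x ∈ S.interval j) :
    mobDeriv (S.rev (c ++ b) : SL(2, ℝ)) x = mobDeriv (S.rev c : SL(2, ℝ)) x *
      mobDeriv (S.rev b : SL(2, ℝ)) (mobR (S.rev c : SL(2, ℝ)) x) := by
  rw [rev_append, Subgroup.coe_mul, mobDeriv_mul _ _ (rev_maps hc hx).1]

lemma mobDeriv_rev_pos {j : Fin m ⊕ Fin m} {r : List (Fin m ⊕ Fin m)} (hr : Adm j r) {x : ℝ}
    (hx : x ∈ S.interval j) : 0 < mobDeriv (S.rev r : SL(2, ℝ)) x :=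
  mobDeriv_pos (rev_maps hr hx).1

lemma IsExpansionBound.one_le_rev {C : ℝ} (hC : S.IsExpansionBound C) {j : Fin m ⊕ Fin m}
    {r : List (Fin m ⊕ Fin m)} (hr : Adm j r) {x : ℝ} (hx : x ∈ S.interval j) :
    1 ≤ C ^ r.length * mobDeriv (S.rev r : SL(2, ℝ)) x := by
  induction r generalizing j x with
  | nil => simp [rev_nil, mobDeriv_one]
  | cons i r ih =>
    rw [mobDeriv_rev_cons hr.1 r hx, List.length_cons, pow_succ]
    have h1 := hC.2 i j hr.1 x hx
    have h2 := ih hr.2 (S.γ_maps_interval hr.1 hx).2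
    calc (1 : ℝ) = 1 * 1 := by ring
      _ ≤ _ := mul_le_mul h1 h2 zero_le_one (zero_le_one.trans h1)
      _ = _ := by ring

variable (S)

/-- Derivatives of long words tend to zero exponentially fast. -/
lemma exists_mobDeriv_rev_le : ∃ q : ℝ, 0 ≤ q ∧ q < 1 ∧ ∀ (j : Fin m ⊕ Fin m), ∀ x ∈ S.interval j,
    ∃ A : ℝ, 0 ≤ A ∧ ∀ r, Adm j r → mobDeriv (S.rev r : SL(2, ℝ)) x ≤ A * q ^ r.length := by
  obtain ⟨q, hq0, hq1, hq⟩ := S.exists_contraction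
  obtain ⟨R, hR1, hR⟩ := S.exists_bound
  refine ⟨q, hq0, hq1, ?_⟩
  have hpos : ∀ k, ∀ x ∈ S.interval k, 1 / (2 * R) ≤ S.hilbertDensity k x := by
    intro k x hx
    have h1 := S.mem_interval.1 hx
    have h2 := hR k x h1.le
    have h3 := hR k (S.center k - S.radius k) (by simp [abs_of_pos (S.radius_pos k)])
    rw [abs_lt] at h1
    rw [abs_le] at h2 h3
    unfold hilbertDensity
    have h4 : 1 / (2 * R) ≤ 1 / (x - (S.center k - S.radius k)) :=
      one_div_le_one_div_of_le (by linarith) (by linarith)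
    have h5 : 0 < 1 / (S.center k + S.radius k - x) := one_div_pos.2 (by linarith)
    linarith
  have key : ∀ r j, Adm j r → ∀ x ∈ S.interval j, mobDeriv (S.rev r : SL(2, ℝ)) x *
      S.hilbertDensity (target j r) (mobR (S.rev r : SL(2, ℝ)) x) ≤
      q ^ r.length * S.hilbertDensity j x := by
    intro r
    induction r with
    | nil => intro j _ x _; simp [rev_nil, mobDeriv_one, mobR_one, target]
    | cons i r ih =>
      intro j hr x hx
      have h1 := hq i j hr.1 x hx
      have h2 := ih i.swap hr.2 _ (S.γ_maps_interval hr.1 hx).2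
      rw [mobDeriv_rev_cons hr.1 r hx, mobR_rev_cons hr.1 r hx, List.length_cons, target, pow_succ,
        mul_assoc, mul_assoc]
      calc _ ≤ mobDeriv (S.γ i) x * (q ^ r.length *
            S.hilbertDensity i.swap (mobR (S.γ i) x)) :=
            mul_le_mul_of_nonneg_left h2 (mobDeriv_nonneg _ _)
        _ = q ^ r.length * (mobDeriv (S.γ i) x *
            S.hilbertDensity i.swap (mobR (S.γ i) x)) := by ring
        _ ≤ _ := mul_le_mul_of_nonneg_left h1 (by positivity)
  intro j x hx
  have hR0 : 0 < 1 / (2 * R) := by positivity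
  refine ⟨2 * R * S.hilbertDensity j x, ?_, fun r hr => ?_⟩
  · have := hpos j x hx
    have : 0 ≤ S.hilbertDensity j x := by linarith
    positivity
  have h1 := key r j hr x hx
  have h2 := hpos _ _ (rev_maps hr hx).2
  have h3 : mobDeriv (S.rev r : SL(2, ℝ)) x * (1 / (2 * R)) ≤ q ^ r.length * S.hilbertDensity j x :=
    (mul_le_mul_of_nonneg_left h2 (mobDeriv_nonneg _ _)).trans h1
  calc mobDeriv (S.rev r : SL(2, ℝ)) x
      = 2 * R * (mobDeriv (S.rev r : SL(2, ℝ)) x * (1 / (2 * R))) := by field_simp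
    _ ≤ 2 * R * (q ^ r.length * S.hilbertDensity j x) := by gcongr
    _ = _ := by ring

/-- The pole of a reduced word lies in the closed interval of its last letter. -/
lemma exists_pole_rev (r : List (Fin m ⊕ Fin m)) (i : Fin m ⊕ Fin m) (hr : Adm i.swap r) :
    ∃ c p : ℝ, c ≠ 0 ∧ |p - S.center i| ≤ S.radius i ∧
      ∀ y, mobDen (S.rev (i :: r) : SL(2, ℝ)) y = c * (y - p) := by
  induction r generalizing i with
  | nil =>
    obtain ⟨p, hp, hp0⟩ := S.exists_pole i
    refine ⟨S.γ i 1 0, p, S.γ_entry_ne_zero i, hp, fun y => ?_⟩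
    rw [coe_rev_cons, rev_nil, Subgroup.coe_one, one_mul]
    unfold mobDen at *
    linear_combination hp0
  | cons l r ih =>
    obtain ⟨c, q, hc, hq, hden⟩ := ih l hr.2
    obtain ⟨h1, h2⟩ := S.γ_maps i.swap (S.radius_lt_of_ne hr.1 hq)
    rw [Sum.swap_swap, S.mem_interval] at h2
    rw [S.γ_swap] at h1 h2
    have e1 : mobDen (S.γ i)⁻¹ q = S.γ i 0 0 - q * S.γ i 1 0 := by
      rw [Matrix.SpecialLinearGroup.SL2_inv_expl]
      simp [mobDen]; ring
    have e2 : mobR (S.γ i)⁻¹ q = (S.γ i 1 1 * q - S.γ i 0 1) / mobDen (S.γ i)⁻¹ q := by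
      rw [Matrix.SpecialLinearGroup.SL2_inv_expl]
      simp [mobDen, mobR]; ring
    refine ⟨c * mobDen (S.γ i)⁻¹ q, mobR (S.γ i)⁻¹ q, mul_ne_zero hc h1, h2.le, fun y => ?_⟩
    have h10 : (S.rev (l :: r) : SL(2, ℝ)) 1 1 = -(c * q) := by
      have := hden 0; simpa [mobDen] using this
    have h11 : (S.rev (l :: r) : SL(2, ℝ)) 1 0 = c := by
      have := hden 1; simp only [mobDen, h10] at this; linarith
    have e3 : mobDen (S.γ i)⁻¹ q * mobR (S.γ i)⁻¹ q = S.γ i 1 1 * q - S.γ i 0 1 := by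
      rw [e2]; field_simp
    rw [coe_rev_cons]
    have e4 : mobDen ((S.rev (l :: r) : SL(2, ℝ)) * S.γ i) y =
        c * (S.γ i 0 0 * y + S.γ i 0 1) - c * q * (S.γ i 1 0 * y + S.γ i 1 1) := by
      simp only [mobDen, Matrix.SpecialLinearGroup.coe_mul, Matrix.mul_apply, Fin.sum_univ_two,
        h10, h11]
      ring
    rw [e4]
    linear_combination c * e3 - c * y * e1

/-- `B ≥ 1`, and the derivatives of a reduced word at any two points to which it can be applied
have a quotient of at most `B`. -/
def IsDistortionBound (B : ℝ) : Prop :=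
  1 ≤ B ∧ ∀ (r : List (Fin m ⊕ Fin m)) (j k : Fin m ⊕ Fin m), Adm j r → Adm k r →
    ∀ x ∈ S.interval j, ∀ y ∈ S.interval k,
    mobDeriv (S.rev r : SL(2, ℝ)) x ≤ B * mobDeriv (S.rev r : SL(2, ℝ)) y

/-- Bounded distortion: a word has the derivative `c⁻² (x - p)⁻²` with its pole `p` in the closed
interval of the letter that acts first, at a definite distance from the other intervals. -/
lemma exists_distortionBound : ∃ B, S.IsDistortionBound B := by
  obtain ⟨g, hg0, hg⟩ := S.exists_gap
  obtain ⟨R, hR1, hR⟩ := S.exists_bound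
  refine ⟨max 1 ((2 * R / g) ^ 2), le_max_left _ _, ?_⟩
  rintro (_ | ⟨i, r⟩) j k hj hk x hx y hy
  · simp [rev_nil, mobDeriv_one]
  · obtain ⟨c, p, hc, hp, hden⟩ := S.exists_pole_rev r i hj.2
    have hx' := (S.mem_interval.1 hx).le
    have hy' := (S.mem_interval.1 hy).le
    have h1 := hg j i hj.1.symm x p hx' hp
    have h2 := hg k i hk.1.symm y p hy' hp
    have h3 := abs_sub y p
    have h4 := hR k y hy'
    have h5 := hR i p hp
    have h6 : 0 < |x - p| := by linarith
    have h7 : 0 < |y - p| := by linarith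
    refine le_trans ?_ (mul_le_mul_of_nonneg_right (le_max_right _ _) (mobDeriv_nonneg _ _))
    unfold mobDeriv
    rw [hden, hden, mul_pow, mul_pow, ← sq_abs (x - p), ← sq_abs (y - p)]
    rw [mul_inv, mul_inv, mul_left_comm]
    refine mul_le_mul_of_nonneg_left ?_ (by positivity)
    rw [inv_le_iff_one_le_mul₀ (by positivity), mul_assoc, mul_comm _ (|x - p| ^ 2),
      ← div_eq_mul_inv, ← div_pow, ← mul_pow]
    refine one_le_pow₀ ?_
    rw [div_mul_div_comm, one_le_div (by positivity)]
    nlinarith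

end SchottkyData

/-! ### Covers of sets of Hausdorff measure zero -/

lemma exists_open_superset_of_ediam {s : ℝ} (hs : 0 < s) {t : Set ℝ} (ht : Metric.ediam t ≤ 1)
    {ε : NNReal} (hε : 0 < ε) : ∃ (U : Set ℝ) (d : ℝ), IsOpen U ∧ t ⊆ U ∧ 0 ≤ d ∧
      (∀ y ∈ U, ∀ y' ∈ U, |y - y'| ≤ d) ∧
      ENNReal.ofReal (d ^ s) ≤ (⨆ _ : t.Nonempty, Metric.ediam t ^ s) + ε := by
  rcases t.eq_empty_or_nonempty with rfl | hne
  · exact ⟨∅, 0, isOpen_empty, le_rfl, le_rfl, by simp, by simp [Real.zero_rpow hs.ne']⟩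
  have htop : Metric.ediam t ≠ ⊤ := ne_top_of_le_ne_top ENNReal.one_ne_top ht
  set D := (Metric.ediam t).toReal with hD
  have hD0 : 0 ≤ D := ENNReal.toReal_nonneg
  have hc : ContinuousAt (fun x : ℝ => (D + 2 * x) ^ s) 0 :=
    ContinuousAt.rpow_const (by fun_prop) (Or.inr hs.le)
  have hev : ∀ᶠ x in 𝓝[>] (0 : ℝ), (D + 2 * x) ^ s < D ^ s + ε := by
    refine (hc.tendsto.mono_left nhdsWithin_le_nhds).eventually_lt_const ?_
    have : (0 : ℝ) < ε := hε
    simpa using this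
  obtain ⟨x, hx, hx0⟩ := (hev.and self_mem_nhdsWithin).exists
  have hx0 : 0 < x := hx0
  refine ⟨Metric.thickening x t, D + 2 * x, Metric.isOpen_thickening,
    Metric.self_subset_thickening hx0 t, by positivity, ?_, ?_⟩
  · intro y hy y' hy'
    obtain ⟨z, hz, hyz⟩ := Metric.mem_thickening_iff.1 hy
    obtain ⟨z', hz', hyz'⟩ := Metric.mem_thickening_iff.1 hy'
    have h1 : dist z z' ≤ D := by
      rw [hD, dist_edist]
      exact ENNReal.toReal_mono htop (Metric.edist_le_ediam_of_mem hz hz')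
    rw [← Real.dist_eq]
    have := dist_triangle4 y z z' y'
    rw [dist_comm z' y'] at this
    linarith
  · have e : Metric.ediam t ^ s = ENNReal.ofReal (D ^ s) := by
      rw [← ENNReal.ofReal_rpow_of_nonneg hD0 hs.le, hD, ENNReal.ofReal_toReal htop]
    rw [iSup_pos hne, e, ← ENNReal.ofReal_coe_nnreal,
      ← ENNReal.ofReal_add (by positivity) ε.coe_nonneg]
    exact ENNReal.ofReal_le_ofReal hx.le

lemma exists_open_cover_of_hausdorffMeasure_eq_zero {T : Set ℝ} {s : ℝ} (hs : 0 < s)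
    (h0 : Measure.hausdorffMeasure s T = 0) {ε : ℝ} (hε : 0 < ε) :
    ∃ (U : ℕ → Set ℝ) (d : ℕ → ℝ), (∀ n, IsOpen (U n)) ∧ T ⊆ ⋃ n, U n ∧ (∀ n, 0 ≤ d n) ∧
      (∀ n, ∀ y ∈ U n, ∀ y' ∈ U n, |y - y'| ≤ d n) ∧ ∀ t : Finset ℕ, ∑ n ∈ t, d n ^ s ≤ ε := by
  have hε2 : ENNReal.ofReal (ε / 2) ≠ 0 := by simpa using hε
  rw [Measure.hausdorffMeasure_apply] at h0
  have h1 := (le_iSup₂_of_le (f := fun (r : ENNReal) (_ : 0 < r) =>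
        ⨅ (t : ℕ → Set ℝ) (_ : T ⊆ ⋃ n, t n) (_ : ∀ n, Metric.ediam (t n) ≤ r),
          ∑' n, ⨆ _ : (t n).Nonempty, Metric.ediam (t n) ^ s) 1 one_pos le_rfl).trans h0.le
  have h2 := lt_of_le_of_lt h1 (pos_iff_ne_zero.2 hε2)
  simp only [iInf_lt_iff] at h2
  obtain ⟨t, htT, ht1, hts⟩ := h2
  obtain ⟨ε', hε', hsum⟩ := ENNReal.exists_pos_sum_of_countable hε2 ℕ
  choose U d hU htU hd hdU hds using
    fun n => exists_open_superset_of_ediam hs (ht1 n) (hε' n)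
  refine ⟨U, d, hU, htT.trans (Set.iUnion_mono htU), hd, hdU, fun F => ?_⟩
  have h3 : ENNReal.ofReal (∑ n ∈ F, d n ^ s) ≤ ENNReal.ofReal ε := by
    rw [ENNReal.ofReal_sum_of_nonneg fun n _ => Real.rpow_nonneg (hd n) s]
    calc ∑ n ∈ F, ENNReal.ofReal (d n ^ s)
        ≤ ∑ n ∈ F, ((⨆ _ : (t n).Nonempty, Metric.ediam (t n) ^ s) + ε' n) :=
          Finset.sum_le_sum fun n _ => hds n
      _ ≤ ∑' n, ((⨆ _ : (t n).Nonempty, Metric.ediam (t n) ^ s) + ε' n) :=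
          ENNReal.sum_le_tsum F
      _ = (∑' n, ⨆ _ : (t n).Nonempty, Metric.ediam (t n) ^ s) + ∑' n, (ε' n : ENNReal) :=
          ENNReal.tsum_add
      _ ≤ ENNReal.ofReal (ε / 2) + ENNReal.ofReal (ε / 2) := add_le_add hts.le hsum.le
      _ = ENNReal.ofReal ε := by
          rw [← ENNReal.ofReal_add (by positivity) (by positivity), add_halves]
  exact (ENNReal.ofReal_le_ofReal_iff hε.le).1 h3

/-- A mass distribution principle for finitely supported probabilities: if the `n`-th one gives a
set of diameter `d` at most the mass `M (d ^ s + θ n)` with `θ n → 0`, and all of them are carried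
by the compact set `T`, then `T` has positive `s`-dimensional Hausdorff measure. -/
lemma hausdorffMeasure_ne_zero_of_finite_mass {α : Type*} {T : Set ℝ} (hT : IsCompact T) {s : ℝ}
    (hs : 0 < s) (E : ℕ → Finset α) (w : ℕ → α → ℝ) (p : α → ℝ)
    (hw : ∀ n, ∀ r ∈ E n, 0 ≤ w n r) (hp : ∀ n, ∀ r ∈ E n, p r ∈ T)
    (hsum : ∀ n, ∑ r ∈ E n, w n r = 1) {M : ℝ} (hM0 : 0 ≤ M) {θ : ℕ → ℝ}
    (hθ : Tendsto θ atTop (𝓝 0))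
    (hM : ∀ n, ∀ E' ⊆ E n, ∀ d : ℝ, 0 ≤ d → (∀ r ∈ E', ∀ r' ∈ E', |p r - p r'| ≤ d) →
      ∑ r ∈ E', w n r ≤ M * (d ^ s + θ n)) :
    Measure.hausdorffMeasure s T ≠ 0 := by
  classical
  intro h0
  obtain ⟨U, d, hU, hTU, hd, hdU, hds⟩ := exists_open_cover_of_hausdorffMeasure_eq_zero hs h0
    (show 0 < 1 / (2 * (M + 1)) by positivity)
  obtain ⟨t, ht⟩ := hT.elim_finite_subcover U hU hTU
  have hle : ∀ n, 1 ≤ ∑ k ∈ t, M * (d k ^ s + θ n) := by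
    intro n
    calc (1 : ℝ) = ∑ r ∈ E n, w n r := (hsum n).symm
      _ ≤ ∑ r ∈ E n, ∑ k ∈ t, if p r ∈ U k then w n r else 0 := by
          refine Finset.sum_le_sum fun r hr => ?_
          obtain ⟨k, hk, hrk⟩ := Set.mem_iUnion₂.1 (ht (hp n r hr))
          refine le_trans (by rw [if_pos hrk])
            (Finset.single_le_sum (f := fun k => if p r ∈ U k then w n r else 0) ?_ hk)
          intro l _
          split_ifs
          exacts [hw n r hr, le_rfl]
      _ = ∑ k ∈ t, ∑ r ∈ (E n).filter fun r => p r ∈ U k, w n r := by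
          rw [Finset.sum_comm]
          simp_rw [Finset.sum_filter]
      _ ≤ _ := by
          refine Finset.sum_le_sum fun k _ => hM n _ (Finset.filter_subset _ _) _ (hd k) ?_
          intro r hr r' hr'
          exact hdU k _ (Finset.mem_filter.1 hr).2 _ (Finset.mem_filter.1 hr').2
  have hlim : Tendsto (fun n => ∑ k ∈ t, M * (d k ^ s + θ n)) atTop
      (𝓝 (∑ k ∈ t, M * (d k ^ s + 0))) :=
    tendsto_finsetSum _ fun k _ => (tendsto_const_nhds.add hθ).const_mul M
  have h1 := ge_of_tendsto' hlim hle
  simp only [add_zero] at h1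
  rw [← Finset.mul_sum] at h1
  have h2 : M * ∑ k ∈ t, d k ^ s ≤ M * (1 / (2 * (M + 1))) :=
    mul_le_mul_of_nonneg_left (hds t) hM0
  have h3 : M * (1 / (2 * (M + 1))) < 1 := by
    rw [mul_one_div, div_lt_one (by positivity)]; linarith
  linarith

lemma List.exists_longest_common_suffix {α : Type*} {E : Finset (List α)} (hE : E.Nonempty)
    {n : ℕ} (hn : ∀ r ∈ E, r.length = n) : ∃ b : List α, (∀ r ∈ E, b <:+ r) ∧
      (E = {b} ∨ ∃ i i' c c', i ≠ i' ∧ c ++ i :: b ∈ E ∧ c' ++ i' :: b ∈ E) := by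
  classical
  obtain ⟨r₀, hr₀⟩ := hE
  have hne : (r₀.tails.toFinset.filter fun b => ∀ r ∈ E, b <:+ r).Nonempty :=
    ⟨[], by simp⟩
  obtain ⟨b, hb, hmax⟩ := Finset.exists_max_image _ List.length hne
  simp only [Finset.mem_filter, List.mem_toFinset, List.mem_tails] at hb hmax
  refine ⟨b, hb.2, ?_⟩
  have hsplit : ∀ r ∈ E, r ≠ b → ∃ c i, r = c ++ i :: b := by
    intro r hr hrb
    obtain ⟨t, rfl⟩ := hb.2 r hr
    rcases List.eq_nil_or_concat t with rfl | ⟨c, i, rfl⟩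
    · simp at hrb
    · exact ⟨c, i, by simp⟩
  by_cases hEb : E = {b}
  · exact Or.inl hEb
  right
  obtain ⟨r, hr, hrb⟩ : ∃ r ∈ E, r ≠ b := by
    by_contra! hcon
    exact hEb (Finset.eq_singleton_iff_nonempty_unique_mem.2 ⟨⟨r₀, hr₀⟩, hcon⟩)
  obtain ⟨c, i, rfl⟩ := hsplit r hr hrb
  obtain ⟨r', hr', hsuf⟩ : ∃ r' ∈ E, ¬ (i :: b) <:+ r' := by
    by_contra! hcon
    have := hmax (i :: b) ⟨hcon r₀ hr₀, hcon⟩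
    simp at this
  have hr'b : r' ≠ b := by
    rintro rfl
    have h1 := hn _ hr
    have h2 := hn _ hr'
    simp at h1
    omega
  obtain ⟨c', i', rfl⟩ := hsplit r' hr' hr'b
  refine ⟨i, i', c, c', ?_, hr, hr'⟩
  rintro rfl
  exact hsuf ⟨c', rfl⟩

namespace SchottkyData

variable {m : ℕ} (S : SchottkyData m)

/-! ### The limit set -/

/-- The real accumulation points of the orbit of `z`. -/
def limitSetOf (z : UpperHalfPlane) : Set ℝ :=
  {x | AccPt (x : ℂ) (𝓟 ((fun w : UpperHalfPlane => (w : ℂ)) '' {w | ∃ g ∈ S.Γ, w = g • z}))}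

lemma limitSetOf_subset (z : UpperHalfPlane) : S.limitSetOf z ⊆ S.Λ := fun _ hx => ⟨z, hx⟩

lemma exists_mem_limitSetOf {x : ℝ} (hx : x ∈ S.Λ) : ∃ z, x ∈ S.limitSetOf z := hx

lemma isClosed_limitSetOf (z : UpperHalfPlane) : IsClosed (S.limitSetOf z) :=
  (isClosed_derivedSet ((fun w : UpperHalfPlane => (w : ℂ)) ''
    {w | ∃ g ∈ S.Γ, w = g • z})).preimage Complex.continuous_ofReal

lemma mobR_mem_limitSetOf {z : UpperHalfPlane} {x : ℝ} (hx : x ∈ S.limitSetOf z) (g : S.Γ)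
    (h0 : mobDen (g : SL(2, ℝ)) x ≠ 0) : mobR (g : SL(2, ℝ)) x ∈ S.limitSetOf z := by
  obtain ⟨g, hg⟩ := g
  simp only at h0 ⊢
  have hx' : AccPt (x : ℂ) _ := hx
  change AccPt ((mobR g x : ℝ) : ℂ) _
  rw [accPt_iff_frequently] at hx' ⊢
  have hden : ContinuousAt (fun y : ℂ => (g 1 0 : ℂ) * y + g 1 1) x := by fun_prop
  have h0' : (g 1 0 : ℂ) * x + g 1 1 ≠ 0 := by
    rw [mobDenC_ofReal]; exact_mod_cast h0
  have hcont : ContinuousAt (mobC g) x := by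
    unfold mobC
    exact ContinuousAt.div (by fun_prop) hden h0'
  rw [← mobC_ofReal]
  have hev := hden.eventually_ne h0'
  refine hcont.tendsto.frequently ((hx'.and_eventually hev).mono ?_)
  rintro y ⟨⟨hyx, ⟨w, ⟨h, hh, rfl⟩, rfl⟩⟩, hy⟩
  refine ⟨?_, ⟨g • (h • z), ⟨g * h, S.Γ.mul_mem hg hh, smul_smul _ _ _⟩, ?_⟩⟩
  · intro heq
    apply hyx
    have hdet : (g 0 0 : ℂ) * g 1 1 - g 0 1 * g 1 0 = 1 := by exact_mod_cast SL2_det g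
    unfold mobC at heq
    rw [div_eq_div_iff hy h0'] at heq
    linear_combination heq - (((h • z : UpperHalfPlane) : ℂ) - x) * hdet
  · simp only [UpperHalfPlane.coe_specialLinearGroup_apply]
    rfl

lemma mobR_mem_Λ {x : ℝ} (hx : x ∈ S.Λ) (g : S.Γ) (h0 : mobDen (g : SL(2, ℝ)) x ≠ 0) :
    mobR (g : SL(2, ℝ)) x ∈ S.Λ := by
  obtain ⟨z, hz⟩ := S.exists_mem_limitSetOf hx
  exact S.limitSetOf_subset z (S.mobR_mem_limitSetOf hz g h0)

lemma dimH_Λ_le_one : dimH S.Λ ≤ 1 :=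
  (dimH_mono (Set.subset_univ _)).trans Real.dimH_univ.le

lemma δ_nonneg : 0 ≤ S.δ := ENNReal.toReal_nonneg

lemma δ_le_one : S.δ ≤ 1 := by
  have := ENNReal.toReal_mono ENNReal.one_ne_top S.dimH_Λ_le_one
  simpa [δ] using this

lemma hausdorffMeasure_Λ_eq_zero {s : ℝ} (hs : S.δ < s) :
    Measure.hausdorffMeasure s S.Λ = 0 := by
  have hs0 : 0 ≤ s := S.δ_nonneg.trans hs.le
  lift s to NNReal using hs0
  refine hausdorffMeasure_of_dimH_lt ?_
  have htop : dimH S.Λ ≠ ⊤ := ne_top_of_le_ne_top ENNReal.one_ne_top S.dimH_Λ_le_one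
  rw [← ENNReal.ofReal_toReal htop, ← ENNReal.ofReal_coe_nnreal]
  exact (ENNReal.ofReal_lt_ofReal_iff_of_nonneg S.δ_nonneg).2 hs

/-! ### Positive eigenfunctions of the transfer operator -/

/-- `φ` is a continuous positive function on `I` with `ℒ_σ φ = lam φ`, where `lam > 0`. -/
structure IsPositiveEigenfunction (σ lam : ℝ) (φ : ℝ → ℝ) : Prop where
  lam_pos : 0 < lam
  continuousOn : ContinuousOn φ S.I
  pos : ∀ j, ∀ x ∈ S.interval j, 0 < φ x
  eigen : ∀ j, ∀ x ∈ S.interval j, lam * φ x =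
    ∑ i ∈ Finset.univ.erase j, mobDeriv (S.γ i) x ^ σ * φ (mobR (S.γ i) x)

variable {S}

lemma interval_subset_I (k : Fin m ⊕ Fin m) : S.interval k ⊆ S.I := Set.subset_iUnion _ k

lemma IsRPFEigenfunction.isPositiveEigenfunction {σ : ℝ} {φ : ℝ → ℝ}
    (h : S.IsRPFEigenfunction σ φ) : S.IsPositiveEigenfunction σ (Real.exp (S.P σ)) φ where
  lam_pos := Real.exp_pos _
  continuousOn := h.contDiffOn.continuousOn
  pos j x hx := h.pos x (interval_subset_I j hx)
  eigen j x hx := by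
    rw [← h.eigen x (interval_subset_I j hx), transferReal, Finset.sum_eq_single j]
    · rw [Set.indicator_of_mem hx]
      refine Finset.sum_congr rfl fun i hi => ?_
      rw [deriv_mobR _ (S.γ_maps_interval (Finset.ne_of_mem_erase hi) hx).1]
    · intro i _ hij
      have hi : x ∉ S.interval i := fun hi => hij (S.disk_disjoint hi hx)
      simp [hi]
    · simp

variable (S) in
/-- A compact subset of `I` which contains all images of points of `I` under generators that may
be applied to them. -/
lemma exists_core : ∃ K ⊆ S.I, IsCompact K ∧ ∀ i k : Fin m ⊕ Fin m, i ≠ k →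
    ∀ x ∈ S.interval k, mobR (S.γ i) x ∈ K := by
  obtain ⟨η, hη0, hη⟩ := S.exists_margin
  refine ⟨⋃ l, Metric.closedBall (S.center l) (S.radius l - η), ?_,
    isCompact_iUnion fun l => isCompact_closedBall _ _, ?_⟩
  · refine Set.iUnion_mono fun l x hx => ?_
    rw [Metric.mem_closedBall, Real.dist_eq] at hx
    exact S.mem_interval.2 (by linarith)
  · intro i k hik x hx
    refine Set.mem_iUnion.2 ⟨i.swap, ?_⟩
    rw [Metric.mem_closedBall, Real.dist_eq]
    exact hη i k hik x (S.mem_interval.1 hx).le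

lemma mobR_rev_mem_of_core {K : Set ℝ} (hK : ∀ i k : Fin m ⊕ Fin m, i ≠ k →
    ∀ x ∈ S.interval k, mobR (S.γ i) x ∈ K) {j : Fin m ⊕ Fin m} {r : List (Fin m ⊕ Fin m)}
    (hr : Adm j r) (hne : r ≠ []) {x : ℝ} (hx : x ∈ S.interval j) :
    mobR (S.rev r : SL(2, ℝ)) x ∈ K := by
  rcases List.eq_nil_or_concat r with rfl | ⟨c, i, rfl⟩
  · exact absurd rfl hne
  · rw [List.concat_eq_append] at hr ⊢
    obtain ⟨h1, h2⟩ := Adm_append.1 hr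
    rw [mobR_rev_append h1 _ hx]
    simpa [coe_rev_cons, rev_nil] using hK i _ h2.1 _ (rev_maps h1 hx).2

namespace IsPositiveEigenfunction

variable {σ lam : ℝ} {φ : ℝ → ℝ}

lemma exists_bounds (h : S.IsPositiveEigenfunction σ lam φ) {K : Set ℝ} (hK : IsCompact K)
    (hKI : K ⊆ S.I) : ∃ a b : ℝ, 0 < a ∧ 0 < b ∧ ∀ y ∈ K, a ≤ φ y ∧ φ y ≤ b := by
  rcases K.eq_empty_or_nonempty with rfl | hne
  · exact ⟨1, 1, one_pos, one_pos, by simp⟩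
  obtain ⟨y, hy, hmin⟩ := hK.exists_isMinOn hne (h.continuousOn.mono hKI)
  obtain ⟨z, hz, hmax⟩ := hK.exists_isMaxOn hne (h.continuousOn.mono hKI)
  have hpos : ∀ y ∈ K, 0 < φ y := by
    intro y hy
    obtain ⟨j, hj⟩ := Set.mem_iUnion.1 (hKI hy)
    exact h.pos j y hj
  exact ⟨φ y, φ z, hpos y hy, hpos z hz, fun u hu => ⟨hmin hu, hmax hu⟩⟩

lemma iterate (h : S.IsPositiveEigenfunction σ lam φ) (n : ℕ) {j : Fin m ⊕ Fin m} {x : ℝ}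
    (hx : x ∈ S.interval j) : lam ^ n * φ x = ∑ r ∈ words n j,
      mobDeriv (S.rev r : SL(2, ℝ)) x ^ σ * φ (mobR (S.rev r : SL(2, ℝ)) x) := by
  induction n generalizing j x with
  | zero => simp [words, rev_nil, mobDeriv_one, mobR_one]
  | succ n ih =>
    rw [sum_words_succ, pow_succ, mul_assoc, h.eigen j x hx, Finset.mul_sum]
    refine Finset.sum_congr rfl fun i hi => ?_
    have hij := Finset.ne_of_mem_erase hi
    rw [mul_left_comm, ih (S.γ_maps_interval hij hx).2, Finset.mul_sum]
    refine Finset.sum_congr rfl fun r _ => ?_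
    rw [mobDeriv_rev_cons hij r hx, mobR_rev_cons hij r hx,
      Real.mul_rpow (mobDeriv_nonneg _ _) (mobDeriv_nonneg _ _), mul_assoc]

/-- Harnack inequality: on a single interval the eigenfunction varies at most by the distortion
constant `B`, which depends neither on `σ` nor on `φ`. In the `n`-th iterate of the eigenvalue
equation the derivatives are comparable, and the values of `φ` become equal in the limit. -/
lemma harnack (h : S.IsPositiveEigenfunction σ lam φ) (hσ : σ ∈ Set.Icc (0 : ℝ) 1) {B : ℝ}
    (hB : S.IsDistortionBound B) {j : Fin m ⊕ Fin m} {x y : ℝ} (hx : x ∈ S.interval j)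
    (hy : y ∈ S.interval j) : φ x ≤ B * φ y := by
  have hB1 := hB.1
  have hBφ : 0 < B * φ y := mul_pos (by linarith) (h.pos j y hy)
  obtain ⟨K, hKI, hK, hKmem⟩ := S.exists_core
  obtain ⟨a, b, ha, hb, hab⟩ := h.exists_bounds hK hKI
  have huc := hK.uniformContinuousOn_of_continuous (h.continuousOn.mono hKI)
  rw [Metric.uniformContinuousOn_iff] at huc
  obtain ⟨q, hq0, hq1, hq⟩ := S.exists_mobDeriv_rev_le
  obtain ⟨A, hA0, hA⟩ := hq j x hx
  obtain ⟨A', hA'0, hA'⟩ := hq j y hy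
  suffices hε : ∀ ε > 0, φ x ≤ B * ((1 + ε) * φ y) by
    refine le_of_forall_pos_le_add fun ε hε0 => ?_
    have := hε (ε / (B * φ y)) (by positivity)
    calc φ x ≤ _ := this
      _ = B * φ y + B * φ y * (ε / (B * φ y)) := by ring
      _ = B * φ y + ε := by rw [mul_div_cancel₀ _ hBφ.ne']
  intro ε hε
  obtain ⟨τ, hτ, hclose⟩ := huc (ε * a) (by positivity)
  have hlim : Tendsto (fun n : ℕ => A * q ^ n * (A' * q ^ n) * (x - y) ^ 2) atTop (𝓝 0) := by
    have hqn := tendsto_pow_atTop_nhds_zero_of_lt_one hq0 hq1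
    simpa using ((hqn.const_mul A).mul (hqn.const_mul A')).mul_const ((x - y) ^ 2)
  obtain ⟨n, hn, hn1⟩ := ((hlim.eventually_lt_const (show (0 : ℝ) < τ ^ 2 by positivity)).and
    (eventually_ge_atTop 1)).exists
  have hlam : 0 < lam ^ n := pow_pos h.lam_pos n
  refine le_of_mul_le_mul_left ?_ hlam
  rw [h.iterate n hx, show lam ^ n * (B * ((1 + ε) * φ y)) = B * (1 + ε) * (lam ^ n * φ y) by ring,
    h.iterate n hy, Finset.mul_sum]
  refine Finset.sum_le_sum fun r hr => ?_
  obtain ⟨hlen, hadm⟩ := mem_words.1 hr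
  have hne : r ≠ [] := by rintro rfl; simp at hlen; omega
  have hxK := mobR_rev_mem_of_core hKmem hadm hne hx
  have hyK := mobR_rev_mem_of_core hKmem hadm hne hy
  have hd : (mobR (S.rev r : SL(2, ℝ)) x - mobR (S.rev r : SL(2, ℝ)) y) ^ 2 < τ ^ 2 := by
    rw [mobR_sub_sq _ (rev_maps hadm hx).1 (rev_maps hadm hy).1]
    refine lt_of_le_of_lt ?_ hn
    rw [← hlen]
    gcongr
    · exact mobDeriv_nonneg _ _
    · exact hA r hadm
    · exact hA' r hadm
  have hφ := hclose _ hxK _ hyK (by rw [Real.dist_eq]; exact abs_lt_of_sq_lt_sq hd hτ.le)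
  rw [Real.dist_eq] at hφ
  have h1 : φ (mobR (S.rev r : SL(2, ℝ)) x) ≤ (1 + ε) * φ (mobR (S.rev r : SL(2, ℝ)) y) := by
    have h2 := (abs_lt.1 hφ).2
    have h3 := mul_le_mul_of_nonneg_left (hab _ hyK).1 hε.le
    linarith
  have h2 : mobDeriv (S.rev r : SL(2, ℝ)) x ^ σ ≤ B * mobDeriv (S.rev r : SL(2, ℝ)) y ^ σ := by
    calc _ ≤ (B * mobDeriv (S.rev r : SL(2, ℝ)) y) ^ σ :=
          Real.rpow_le_rpow (mobDeriv_nonneg _ _) (hB.2 r j j hadm hadm x hx y hy) hσ.1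
      _ = B ^ σ * mobDeriv (S.rev r : SL(2, ℝ)) y ^ σ :=
          Real.mul_rpow (by linarith) (mobDeriv_nonneg _ _)
      _ ≤ _ := by
          refine mul_le_mul_of_nonneg_right ?_ (Real.rpow_nonneg (mobDeriv_nonneg _ _) _)
          exact Real.rpow_le_self_of_one_le hB.1 hσ.2
  calc _ ≤ (B * mobDeriv (S.rev r : SL(2, ℝ)) y ^ σ) *
        ((1 + ε) * φ (mobR (S.rev r : SL(2, ℝ)) y)) :=
        mul_le_mul h2 h1 (h.pos _ _ (rev_maps hadm hx).2).le
          (mul_nonneg (by linarith) (Real.rpow_nonneg (mobDeriv_nonneg _ _) _))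
    _ = _ := by ring

/-- The value of the eigenfunction drops at most by a controlled factor along a generator: from
`γ_i x` the generator `γ_j⁻¹` leads back into the interval `I_j` of `x`. -/
lemma le_apply_γ (h : S.IsPositiveEigenfunction σ lam φ) (hσ : σ ∈ Set.Icc (0 : ℝ) 1) {B C : ℝ}
    (hB : S.IsDistortionBound B) (hC : S.IsExpansionBound C)
    {i j : Fin m ⊕ Fin m} (hij : i ≠ j) {x : ℝ} (hx : x ∈ S.interval j) :
    φ x ≤ B * C * lam * φ (mobR (S.γ i) x) := by
  have hB1 := hB.1
  have hC1 := hC.1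
  have hy := (S.γ_maps_interval hij hx).2
  set y := mobR (S.γ i) x
  have hji : j.swap ≠ i.swap := fun e => hij (by simpa using (congrArg Sum.swap e).symm)
  have hz := (S.γ_maps_interval hji hy).2
  rw [Sum.swap_swap] at hz
  have h1 := h.harnack hσ hB hx hz
  have h2 := h.eigen _ y hy
  have h3 : mobDeriv (S.γ j.swap) y ^ σ * φ (mobR (S.γ j.swap) y) ≤ lam * φ y := by
    rw [h2]
    refine Finset.single_le_sum
      (f := fun k => mobDeriv (S.γ k) y ^ σ * φ (mobR (S.γ k) y)) ?_
      (Finset.mem_erase.2 ⟨hji, Finset.mem_univ _⟩)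
    intro k hk
    exact mul_nonneg (Real.rpow_nonneg (mobDeriv_nonneg _ _) _)
      (h.pos _ _ (S.γ_maps_interval (Finset.ne_of_mem_erase hk) hy).2).le
  have h4 : 1 ≤ C * mobDeriv (S.γ j.swap) y ^ σ := by
    calc (1 : ℝ) ≤ (C * mobDeriv (S.γ j.swap) y) ^ σ :=
          Real.one_le_rpow (hC.2 _ _ hji y hy) hσ.1
      _ = C ^ σ * mobDeriv (S.γ j.swap) y ^ σ :=
          Real.mul_rpow (by linarith) (mobDeriv_nonneg _ _)
      _ ≤ _ := by
          refine mul_le_mul_of_nonneg_right ?_ (Real.rpow_nonneg (mobDeriv_nonneg _ _) _)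
          exact Real.rpow_le_self_of_one_le hC.1 hσ.2
  have hφz := h.pos _ _ hz
  calc φ x ≤ B * (1 * φ (mobR (S.γ j.swap) y)) := by rwa [one_mul]
    _ ≤ B * ((C * mobDeriv (S.γ j.swap) y ^ σ) * φ (mobR (S.γ j.swap) y)) := by gcongr
    _ = B * C * (mobDeriv (S.γ j.swap) y ^ σ * φ (mobR (S.γ j.swap) y)) := by ring
    _ ≤ B * C * (lam * φ y) := by gcongr
    _ = _ := by ring

end IsPositiveEigenfunction

/-! ### The eigenvalue and the dimension of the limit set -/

/-- If the word `w` can be applied to points `u`, `v` of two different intervals, then the distance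
of the images of `u` and `v` controls the derivative of `w`. -/
lemma mobDeriv_rev_le_of_dist {g : ℝ} (hg0 : 0 < g) (hg : ∀ i k : Fin m ⊕ Fin m, i ≠ k →
      ∀ x y : ℝ, |x - S.center i| ≤ S.radius i → |y - S.center k| ≤ S.radius k → g ≤ |x - y|)
    {B : ℝ} (hB : S.IsDistortionBound B) {w : List (Fin m ⊕ Fin m)} {k l : Fin m ⊕ Fin m}
    (hkl : k ≠ l) (hk : Adm k w) (hl : Adm l w) {u v d : ℝ} (hu : u ∈ S.interval k)
    (hv : v ∈ S.interval l)
    (hd : |mobR (S.rev w : SL(2, ℝ)) u - mobR (S.rev w : SL(2, ℝ)) v| ≤ d) :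
    mobDeriv (S.rev w : SL(2, ℝ)) u ≤ B / g * d := by
  have huv := hg _ _ hkl u v (S.mem_interval.1 hu).le (S.mem_interval.1 hv).le
  have hDu := mobDeriv_rev_pos hk hu
  have hDv := mobDeriv_rev_pos hl hv
  have hDuv := hB.2 w _ _ hk hl u hu v hv
  have h1 := mobR_sub_sq (S.rev w : SL(2, ℝ)) (rev_maps hk hu).1 (rev_maps hl hv).1
  have hB1 := hB.1
  have hd0 : 0 ≤ d := (abs_nonneg _).trans hd
  set Du := mobDeriv (S.rev w : SL(2, ℝ)) u
  set Dv := mobDeriv (S.rev w : SL(2, ℝ)) v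
  have h2 : (Du * g) ^ 2 ≤ (B * d) ^ 2 := by
    calc (Du * g) ^ 2 = Du * Du * g ^ 2 := by ring
      _ ≤ Du * (B * Dv) * |u - v| ^ 2 := by
          have : 0 ≤ Du * (B * Dv) := by positivity
          gcongr
      _ = B * (mobR (S.rev w : SL(2, ℝ)) u - mobR (S.rev w : SL(2, ℝ)) v) ^ 2 := by
          rw [h1, sq_abs]; ring
      _ ≤ B * d ^ 2 := by
          rw [← sq_abs (_ - _)]; gcongr
      _ ≤ B ^ 2 * d ^ 2 := by
          have : B ≤ B ^ 2 := le_self_pow₀ hB1 two_ne_zero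
          gcongr
      _ = (B * d) ^ 2 := by ring
  have h3 := (sq_le_sq₀ (by positivity) (by positivity)).1 h2
  rw [div_mul_eq_mul_div, le_div_iff₀ hg0]
  exact h3

variable (S) in
/-- The weight of the (reversed) word `r` in the `n`-th iterate of the transfer operator at `x`,
normalized by means of the eigenfunction `φ` so that the weights of the words of length `n` have
the sum `1`. They are the masses of a discrete approximation, with atoms `γ_r x`, to the
eigenmeasure of the dual operator. -/
def weight (σ lam : ℝ) (φ : ℝ → ℝ) (x : ℝ) (n : ℕ) (r : List (Fin m ⊕ Fin m)) : ℝ :=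
  mobDeriv (S.rev r : SL(2, ℝ)) x ^ σ * φ (mobR (S.rev r : SL(2, ℝ)) x) / (lam ^ n * φ x)

namespace IsPositiveEigenfunction

variable {σ lam : ℝ} {φ : ℝ → ℝ}

lemma weight_nonneg (h : S.IsPositiveEigenfunction σ lam φ) {j : Fin m ⊕ Fin m} {x : ℝ}
    (hx : x ∈ S.interval j) (n : ℕ) {r : List (Fin m ⊕ Fin m)} (hr : Adm j r) :
    0 ≤ S.weight σ lam φ x n r := by
  have := h.lam_pos
  have := h.pos j x hx
  have := h.pos _ _ (rev_maps hr hx).2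
  have := Real.rpow_nonneg (mobDeriv_nonneg (S.rev r : SL(2, ℝ)) x) σ
  unfold weight
  positivity

lemma sum_weight (h : S.IsPositiveEigenfunction σ lam φ) {j : Fin m ⊕ Fin m} {x : ℝ}
    (hx : x ∈ S.interval j) (n : ℕ) : ∑ r ∈ words n j, S.weight σ lam φ x n r = 1 := by
  have := h.lam_pos
  have := h.pos j x hx
  unfold weight
  rw [← Finset.sum_div, ← h.iterate n hx, div_self (by positivity)]

/-- The mass of a cylinder: the words of length `n` with the prefix `w` have a total weight of at
most a constant times `lam ^ (-|w|) γ_w' ^ σ`. -/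
lemma sum_weight_le (h : S.IsPositiveEigenfunction σ lam φ) (hσ : σ ∈ Set.Icc (0 : ℝ) 1)
    {B : ℝ} (hB : S.IsDistortionBound B) {j : Fin m ⊕ Fin m} {x : ℝ} (hx : x ∈ S.interval j)
    {a b : ℝ} (ha : 0 < a) (hab : ∀ r, Adm j r → a ≤ φ (mobR (S.rev r : SL(2, ℝ)) x) ∧
      φ (mobR (S.rev r : SL(2, ℝ)) x) ≤ b) {n : ℕ} {E : Finset (List (Fin m ⊕ Fin m))}
    (hE : E ⊆ words n j) {w : List (Fin m ⊕ Fin m)} (hw : ∀ r ∈ E, w <:+ r) {k : Fin m ⊕ Fin m}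
    (hk : Adm k w) {u : ℝ} (hu : u ∈ S.interval k) :
    ∑ r ∈ E, S.weight σ lam φ x n r ≤
      b / a * (B * (mobDeriv (S.rev w : SL(2, ℝ)) u ^ σ / lam ^ w.length)) := by
  have hl := h.lam_pos
  have hφx := h.pos j x hx
  have hDu := mobDeriv_rev_pos hk hu
  have hB1 := hB.1
  have hb : 0 < b := by
    have := hab [] trivial
    linarith
  have hterm : ∀ e, Adm j (e ++ w) → e.length + w.length = n →
      S.weight σ lam φ x n (e ++ w) ≤ S.weight σ lam φ x e.length e *
        (b / a * (B * (mobDeriv (S.rev w : SL(2, ℝ)) u ^ σ / lam ^ w.length))) := by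
    intro e hew hlen
    obtain ⟨he1, he2⟩ := Adm_append.1 hew
    have hy := (rev_maps he1 hx).2
    have hyφ := h.pos _ _ hy
    have hewφ := h.pos _ _ (rev_maps hew hx).2
    have h4 : φ (mobR (S.rev (e ++ w) : SL(2, ℝ)) x) ≤
        φ (mobR (S.rev e : SL(2, ℝ)) x) * (b / a) := by
      rw [mul_div_assoc', le_div_iff₀ ha, mul_comm]
      exact mul_le_mul (hab _ he1).1 (hab _ hew).2 hewφ.le hyφ.le
    have h7 : mobDeriv (S.rev w : SL(2, ℝ)) (mobR (S.rev e : SL(2, ℝ)) x) ^ σ ≤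
        B * mobDeriv (S.rev w : SL(2, ℝ)) u ^ σ := by
      calc _ ≤ (B * mobDeriv (S.rev w : SL(2, ℝ)) u) ^ σ :=
            Real.rpow_le_rpow (mobDeriv_nonneg _ _) (hB.2 w _ _ he2 hk _ hy u hu) hσ.1
        _ = B ^ σ * mobDeriv (S.rev w : SL(2, ℝ)) u ^ σ :=
            Real.mul_rpow (by linarith) hDu.le
        _ ≤ _ := by
            refine mul_le_mul_of_nonneg_right ?_ (Real.rpow_nonneg hDu.le _)
            exact Real.rpow_le_self_of_one_le hB1 hσ.2
    have hDe := Real.rpow_nonneg (mobDeriv_nonneg (S.rev e : SL(2, ℝ)) x) σ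
    have hDw := Real.rpow_nonneg (mobDeriv_nonneg (S.rev w : SL(2, ℝ))
      (mobR (S.rev e : SL(2, ℝ)) x)) σ
    calc S.weight σ lam φ x n (e ++ w) = mobDeriv (S.rev e : SL(2, ℝ)) x ^ σ *
          mobDeriv (S.rev w : SL(2, ℝ)) (mobR (S.rev e : SL(2, ℝ)) x) ^ σ *
          φ (mobR (S.rev (e ++ w) : SL(2, ℝ)) x) /
          (lam ^ e.length * lam ^ w.length * φ x) := by
          unfold weight
          rw [mobDeriv_rev_append he1 w hx,
            Real.mul_rpow (mobDeriv_nonneg _ _) (mobDeriv_nonneg _ _), ← pow_add, hlen]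
      _ ≤ mobDeriv (S.rev e : SL(2, ℝ)) x ^ σ * (B * mobDeriv (S.rev w : SL(2, ℝ)) u ^ σ) *
          (φ (mobR (S.rev e : SL(2, ℝ)) x) * (b / a)) /
          (lam ^ e.length * lam ^ w.length * φ x) := by
          gcongr
      _ = _ := by
          unfold weight; field_simp
  have hE' : ∀ r ∈ E, ∃ e ∈ words (n - w.length) j, e ++ w = r ∧ e.length + w.length = n := by
    intro r hr
    obtain ⟨e, rfl⟩ := hw r hr
    obtain ⟨h1, h2⟩ := mem_words.1 (hE hr)
    rw [List.length_append] at h1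
    exact ⟨e, mem_words.2 ⟨by omega, (Adm_append.1 h2).1⟩, rfl, h1⟩
  choose! f hf1 hf2 hf3 using hE'
  have hDσ := Real.rpow_nonneg hDu.le σ
  calc ∑ r ∈ E, S.weight σ lam φ x n r
      ≤ ∑ r ∈ E, S.weight σ lam φ x (n - w.length) (f r) *
        (b / a * (B * (mobDeriv (S.rev w : SL(2, ℝ)) u ^ σ / lam ^ w.length))) := by
        refine Finset.sum_le_sum fun r hr => ?_
        have h1 := hterm (f r) (by rw [hf2 r hr]; exact (mem_words.1 (hE hr)).2) (hf3 r hr)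
        rwa [hf2 r hr, (mem_words.1 (hf1 r hr)).1] at h1
    _ = (∑ e ∈ E.image f, S.weight σ lam φ x (n - w.length) e) *
        (b / a * (B * (mobDeriv (S.rev w : SL(2, ℝ)) u ^ σ / lam ^ w.length))) := by
        rw [Finset.sum_image, Finset.sum_mul]
        intro r hr r' hr' hrr'
        rw [← hf2 r hr, ← hf2 r' hr', hrr']
    _ ≤ (∑ e ∈ words (n - w.length) j, S.weight σ lam φ x (n - w.length) e) *
        (b / a * (B * (mobDeriv (S.rev w : SL(2, ℝ)) u ^ σ / lam ^ w.length))) := by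
        refine mul_le_mul_of_nonneg_right ?_ (by positivity)
        refine Finset.sum_le_sum_of_subset_of_nonneg ?_ fun e he _ => ?_
        · exact Finset.image_subset_iff.2 hf1
        · exact h.weight_nonneg hx _ (mem_words.1 he).2
    _ = _ := by rw [h.sum_weight hx, one_mul]

/-- An upper bound for the eigenvalue. If it failed, the atoms `γ_r x` of mass `weight` would obey
a Frostman condition with exponent `s`: a set of diameter `d` meets only words with a common
prefix `w` such that `γ_w' ≲ d`, and the total mass of these is
`≲ lam ^ (-|w|) γ_w' ^ σ ≤ γ_w' ^ s`. This is impossible for `s > δ`. -/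
lemma lam_le_rpow_of_lt (h : S.IsPositiveEigenfunction σ lam φ) (hσ : σ ∈ Set.Icc 0 S.δ)
    {C : ℝ} (hC : S.IsExpansionBound C) {j : Fin m ⊕ Fin m} {x : ℝ} (hxΛ : x ∈ S.Λ)
    (hx : x ∈ S.interval j) {s : ℝ} (hs : S.δ < s) : lam ≤ C ^ (s - σ) := by
  have hC1 := hC.1
  by_contra! hlam
  have hs0 : 0 < s := S.δ_nonneg.trans_lt hs
  have hsσ : 0 ≤ s - σ := by linarith [hσ.2]
  have hl := h.lam_pos
  have hgrow : ∀ b k, ∀ u ∈ S.interval k, Adm k b →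
      mobDeriv (S.rev b : SL(2, ℝ)) u ^ σ / lam ^ b.length ≤
        mobDeriv (S.rev b : SL(2, ℝ)) u ^ s := by
    intro b k u hu hb
    have h1 := hC.one_le_rev hb hu
    have hD := mobDeriv_rev_pos hb hu
    set D := mobDeriv (S.rev b : SL(2, ℝ)) u
    have h2 : 1 ≤ lam ^ b.length * D ^ (s - σ) := by
      calc (1 : ℝ) ≤ (C ^ b.length * D) ^ (s - σ) := Real.one_le_rpow h1 hsσ
        _ = (C ^ (s - σ)) ^ b.length * D ^ (s - σ) := by
            rw [Real.mul_rpow (by positivity) hD.le, ← Real.rpow_natCast, ← Real.rpow_natCast,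
              ← Real.rpow_mul (by linarith), ← Real.rpow_mul (by linarith), mul_comm (s - σ)]
        _ ≤ _ := by gcongr
    rw [div_le_iff₀ (by positivity), show s = σ + (s - σ) by ring, Real.rpow_add hD]
    calc D ^ σ = D ^ σ * 1 := (mul_one _).symm
      _ ≤ D ^ σ * (lam ^ b.length * D ^ (s - σ)) := by gcongr
      _ = _ := by ring
  obtain ⟨K, hKI, hK, hKmem⟩ := S.exists_core
  obtain ⟨a, b, ha, hb, hab'⟩ := h.exists_bounds (hK.insert x)
    (Set.insert_subset (interval_subset_I j hx) hKI)
  have hab : ∀ r, Adm j r → a ≤ φ (mobR (S.rev r : SL(2, ℝ)) x) ∧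
      φ (mobR (S.rev r : SL(2, ℝ)) x) ≤ b := by
    intro r hr
    refine hab' _ ?_
    by_cases hne : r = []
    · left; rw [hne, rev_nil]; exact mobR_one x
    · right; exact mobR_rev_mem_of_core hKmem hr hne hx
  obtain ⟨g, hg0, hg⟩ := S.exists_gap
  obtain ⟨R, hR1, hR⟩ := S.exists_bound
  obtain ⟨B, hB⟩ := S.exists_distortionBound
  have hB1 := hB.1
  obtain ⟨q, hq0, hq1, hq⟩ := S.exists_mobDeriv_rev_le
  obtain ⟨A, hA0, hA⟩ := hq j x hx
  obtain ⟨z, hz⟩ := S.exists_mem_limitSetOf hxΛ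
  set T := closure {y | ∃ r, Adm j r ∧ y = mobR (S.rev r : SL(2, ℝ)) x}
  have hTΛ : T ⊆ S.Λ := by
    refine (closure_minimal ?_ (S.isClosed_limitSetOf z)).trans (S.limitSetOf_subset z)
    rintro y ⟨r, hr, rfl⟩
    exact S.mobR_mem_limitSetOf hz _ (rev_maps hr hx).1
  have hTc : IsCompact T := by
    refine Bornology.IsBounded.isCompact_closure ?_
    refine (Metric.isBounded_closedBall (x := (0 : ℝ)) (r := R)).subset ?_
    rintro y ⟨r, hr, rfl⟩
    rw [Metric.mem_closedBall, Real.dist_eq, sub_zero]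
    exact hR _ _ (S.mem_interval.1 (rev_maps hr hx).2).le
  have hba : 0 ≤ b / a := by positivity
  have hBg : 0 ≤ B * (B / g) ^ s := by positivity
  refine hausdorffMeasure_ne_zero_of_finite_mass hTc hs0 (fun n => words n j)
    (S.weight σ lam φ x) (fun r => mobR (S.rev r : SL(2, ℝ)) x)
    (fun n r hr => h.weight_nonneg hx n (mem_words.1 hr).2)
    (fun n r hr => subset_closure ⟨r, (mem_words.1 hr).2, rfl⟩) (h.sum_weight hx)
    (M := b / a * (B + B * (B / g) ^ s)) (by positivity) (θ := fun n => (A * q ^ n) ^ s) ?_ ?_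
    (measure_mono_null hTΛ (S.hausdorffMeasure_Λ_eq_zero hs))
  · have hqn := (tendsto_pow_atTop_nhds_zero_of_lt_one hq0 hq1).const_mul A
    rw [mul_zero] at hqn
    simpa [Real.zero_rpow hs0.ne'] using hqn.rpow_const (p := s) (Or.inr hs0.le)
  intro n E hE d hd hdE
  have hθ : 0 ≤ (A * q ^ n) ^ s := by positivity
  have hds : 0 ≤ d ^ s := by positivity
  rcases E.eq_empty_or_nonempty with rfl | hne
  · rw [Finset.sum_empty]; positivity
  -- As words are read backwards, their longest common prefix appears as a suffix.
  obtain ⟨w, hw, hcase⟩ := List.exists_longest_common_suffix hne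
    (fun r hr => (mem_words.1 (hE hr)).1)
  have hmass : ∀ k, ∀ u ∈ S.interval k, Adm k w → ∑ r ∈ E, S.weight σ lam φ x n r ≤
      b / a * (B * mobDeriv (S.rev w : SL(2, ℝ)) u ^ s) := by
    intro k u hu hk
    refine (h.sum_weight_le ⟨hσ.1, hσ.2.trans S.δ_le_one⟩ hB hx ha hab hE hw hk hu).trans ?_
    gcongr
    exact hgrow w k u hu hk
  rcases hcase with hEw | ⟨i, i', c, c', hii', hc, hc'⟩
  · obtain ⟨hlen, hadm⟩ := mem_words.1 (hE (show w ∈ E by rw [hEw]; simp))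
    have h2 : mobDeriv (S.rev w : SL(2, ℝ)) x ^ s ≤ (A * q ^ n) ^ s := by
      rw [← hlen]
      exact Real.rpow_le_rpow (mobDeriv_nonneg _ _) (hA w hadm) hs0.le
    calc _ ≤ b / a * (B * mobDeriv (S.rev w : SL(2, ℝ)) x ^ s) := hmass j x hx hadm
      _ ≤ b / a * (B * (A * q ^ n) ^ s) := by gcongr
      _ ≤ b / a * (B + B * (B / g) ^ s) * (d ^ s + (A * q ^ n) ^ s) := by
          rw [mul_assoc (b / a)]
          refine mul_le_mul_of_nonneg_left ?_ hba
          exact mul_le_mul (by linarith) (by linarith) hθ (by positivity)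
  · have split : ∀ (l : Fin m ⊕ Fin m) (e : List (Fin m ⊕ Fin m)), e ++ l :: w ∈ E →
        Adm l.swap w ∧ mobR (S.rev (e ++ [l]) : SL(2, ℝ)) x ∈ S.interval l.swap ∧
        mobR (S.rev (e ++ l :: w) : SL(2, ℝ)) x =
          mobR (S.rev w : SL(2, ℝ)) (mobR (S.rev (e ++ [l]) : SL(2, ℝ)) x) := by
      intro l e he
      have h1 := (mem_words.1 (hE he)).2
      rw [show e ++ l :: w = (e ++ [l]) ++ w by simp] at h1 ⊢
      obtain ⟨h2, h3⟩ := Adm_append.1 h1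
      have h4 := (rev_maps h2 hx).2
      rw [target_append] at h3 h4
      exact ⟨h3, h4, mobR_rev_append h2 w hx⟩
    obtain ⟨hu1, hu2, hu3⟩ := split i c hc
    obtain ⟨hv1, hv2, hv3⟩ := split i' c' hc'
    have hdist := hdE _ hc _ hc'
    simp only [hu3, hv3] at hdist
    have hne' : i.swap ≠ i'.swap := fun e => hii' (by simpa using congrArg Sum.swap e)
    have hDd := mobDeriv_rev_le_of_dist hg0 hg hB hne' hu1 hv1 hu2 hv2 hdist
    set u := mobR (S.rev (c ++ [i]) : SL(2, ℝ)) x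
    have hDu := mobDeriv_rev_pos hu1 hu2
    calc _ ≤ b / a * (B * mobDeriv (S.rev w : SL(2, ℝ)) u ^ s) := hmass _ u hu2 hu1
      _ ≤ b / a * (B * (B / g * d) ^ s) := by gcongr
      _ = b / a * (B * (B / g) ^ s * d ^ s) := by
          rw [Real.mul_rpow (by positivity) hd]; ring
      _ ≤ b / a * (B + B * (B / g) ^ s) * (d ^ s + (A * q ^ n) ^ s) := by
          rw [mul_assoc (b / a)]
          refine mul_le_mul_of_nonneg_left ?_ hba
          exact mul_le_mul (by linarith) (by linarith) hds (by positivity)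

/-- The eigenvalue satisfies `lam ≤ C ^ (δ - σ)`; this is the half `P(δ) ≤ 0` of Bowen's formula,
together with the Lipschitz continuity of the pressure. -/
lemma lam_le_rpow (h : S.IsPositiveEigenfunction σ lam φ) (hσ : σ ∈ Set.Icc 0 S.δ)
    {C : ℝ} (hC : S.IsExpansionBound C) {j : Fin m ⊕ Fin m} {x : ℝ} (hxΛ : x ∈ S.Λ)
    (hx : x ∈ S.interval j) : lam ≤ C ^ (S.δ - σ) := by
  have hC0 : (0 : ℝ) < C := zero_lt_one.trans_le hC.1
  have hc : ContinuousAt (fun s : ℝ => C ^ (s - σ)) S.δ :=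
    ContinuousAt.rpow continuousAt_const (by fun_prop) (Or.inl hC0.ne')
  refine ge_of_tendsto (hc.tendsto.mono_left (nhdsWithin_le_nhds (s := Set.Ioi S.δ))) ?_
  filter_upwards [self_mem_nhdsWithin] with s hs
  exact h.lam_le_rpow_of_lt hσ hC hxΛ hx hs

end IsPositiveEigenfunction

end SchottkyData

/-! ### Strict convexity -/

/-- A quantitative form of strict convexity: if `f` is a combination, with weights of total `κ`
close to `1`, of vectors which are not longer than `f`, then they are close to `f`. -/
lemma mul_norm_sub_sq_le_of_eq_sum {ι V : Type*} [NormedAddCommGroup V] [InnerProductSpace ℂ V]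
    {t : Finset ι} {p : ι → ℝ} {u : ι → V} {f : V} {κ : ℝ} (hf : f = ∑ i ∈ t, (p i : ℂ) • u i)
    (hp : ∀ i ∈ t, 0 ≤ p i) (hu : ∀ i ∈ t, ‖u i‖ ≤ ‖f‖) (hκ : ∑ i ∈ t, p i = κ) {i : ι}
    (hi : i ∈ t) : p i * ‖f - u i‖ ^ 2 ≤ 2 * (κ - 1) * ‖f‖ ^ 2 := by
  have h1 : ‖f‖ ^ 2 = ∑ i ∈ t, p i * RCLike.re (inner ℂ f (u i)) := by
    calc ‖f‖ ^ 2 = RCLike.re (inner ℂ f (∑ i ∈ t, (p i : ℂ) • u i)) := by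
          rw [← hf]; exact norm_sq_eq_re_inner f
      _ = _ := by
          rw [inner_sum, map_sum]
          refine Finset.sum_congr rfl fun i _ => ?_
          rw [inner_smul_right]
          simp
  calc p i * ‖f - u i‖ ^ 2 ≤ ∑ i ∈ t, p i * ‖f - u i‖ ^ 2 :=
        Finset.single_le_sum (f := fun i => p i * ‖f - u i‖ ^ 2)
          (fun k hk => mul_nonneg (hp k hk) (sq_nonneg _)) hi
    _ ≤ ∑ i ∈ t, (2 * ‖f‖ ^ 2 * p i - 2 * (p i * RCLike.re (inner ℂ f (u i)))) := by
        refine Finset.sum_le_sum fun k hk => ?_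
        rw [norm_sub_sq (𝕜 := ℂ)]
        have h2 : ‖u k‖ ^ 2 ≤ ‖f‖ ^ 2 := pow_le_pow_left₀ (norm_nonneg _) (hu k hk) 2
        have h3 := mul_le_mul_of_nonneg_left h2 (hp k hk)
        linarith
    _ = 2 * (κ - 1) * ‖f‖ ^ 2 := by
        rw [Finset.sum_sub_distrib, ← Finset.mul_sum, ← Finset.mul_sum, hκ, ← h1]; ring

namespace SchottkyData

variable {m : ℕ} {S : SchottkyData m}

lemma IsPositiveEigenfunction.le_apply_rev {σ lam : ℝ} {φ : ℝ → ℝ}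
    (h : S.IsPositiveEigenfunction σ lam φ) (hσ : σ ∈ Set.Icc (0 : ℝ) 1) {B C : ℝ}
    (hB : S.IsDistortionBound B) (hC : S.IsExpansionBound C) {j : Fin m ⊕ Fin m}
    {r : List (Fin m ⊕ Fin m)} (hr : Adm j r) {x : ℝ} (hx : x ∈ S.interval j) :
    φ x ≤ (B * C * lam) ^ r.length * φ (mobR (S.rev r : SL(2, ℝ)) x) := by
  have hpos : 0 ≤ B * C * lam :=
    mul_nonneg (mul_nonneg (by linarith [hB.1]) (by linarith [hC.1])) h.lam_pos.le
  induction r generalizing j x with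
  | nil => simp [rev_nil, mobR_one]
  | cons i r ih =>
    rw [mobR_rev_cons hr.1 r hx, List.length_cons, pow_succ', mul_assoc]
    exact (h.le_apply_γ hσ hB hC hr.1 hx).trans
      (mul_le_mul_of_nonneg_left (ih hr.2 (S.γ_maps_interval hr.1 hx).2) hpos)

variable {V : Type*} [NormedAddCommGroup V] [InnerProductSpace ℂ V]

lemma eq_sum_words_of_transfer_eq {s : ℂ} {ρ : S.Γ →* (V ≃ₗᵢ[ℂ] V)} {F : ℂ → V}
    (hF : ∀ z ∈ S.D, S.transfer s ρ F z = F z) (n : ℕ) {j : Fin m ⊕ Fin m} {x : ℝ}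
    (hx : x ∈ S.interval j) : F x = ∑ r ∈ words n j,
      ((mobDeriv (S.rev r : SL(2, ℝ)) x : ℝ) : ℂ) ^ s •
        (ρ (S.rev r))⁻¹ (F (mobR (S.rev r : SL(2, ℝ)) x : ℝ)) := by
  induction n generalizing j x with
  | zero =>
    simp only [words, Finset.sum_singleton, rev_nil, Subgroup.coe_one, mobDeriv_one, mobR_one,
      Complex.ofReal_one, Complex.one_cpow, one_smul, map_one, inv_one]
    rfl
  | succ n ih =>
    rw [sum_words_succ, ← hF x (Set.mem_iUnion.2 ⟨j, hx⟩), S.transfer_of_mem s ρ F hx]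
    refine Finset.sum_congr rfl fun i hi => ?_
    have hij := Finset.ne_of_mem_erase hi
    obtain ⟨h0, h1⟩ := S.γ_maps_interval hij hx
    rw [deriv_mobC _ h0, mobC_ofReal, ih h1, map_sum, Finset.smul_sum]
    refine Finset.sum_congr rfl fun r _ => ?_
    rw [mobDeriv_rev_cons hij r hx, mobR_rev_cons hij r hx, Complex.ofReal_mul,
      Complex.mul_cpow_ofReal_nonneg (mobDeriv_nonneg _ _) (mobDeriv_nonneg _ _), _root_.map_smul,
      smul_smul, rev_cons, map_mul, mul_inv_rev, LinearIsometryEquiv.coe_mul, Function.comp_apply]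

/-- The value of `f = φ⁻¹ F` is a combination of the vectors which are to be compared with it,
with the positive weights of the untwisted operator. -/
lemma quotientBy_eq_sum {s : ℂ} {lam : ℝ} {φ : ℝ → ℝ} (h : S.IsPositiveEigenfunction s.re lam φ)
    {ρ : S.Γ →* (V ≃ₗᵢ[ℂ] V)} {F : ℂ → V} (hF : ∀ z ∈ S.D, S.transfer s ρ F z = F z) (n : ℕ)
    {j : Fin m ⊕ Fin m} {x : ℝ} (hx : x ∈ S.interval j) :
    quotientBy φ F x = ∑ r ∈ words n j,
      ((mobDeriv (S.rev r : SL(2, ℝ)) x ^ s.re * φ (mobR (S.rev r : SL(2, ℝ)) x) / φ x : ℝ) : ℂ) •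
        ((mobDeriv (S.rev r : SL(2, ℝ)) x : ℝ) : ℂ) ^ (Complex.I * s.im) •
          (ρ (S.rev r))⁻¹ (quotientBy φ F (mobR (S.rev r : SL(2, ℝ)) x)) := by
  unfold quotientBy
  rw [eq_sum_words_of_transfer_eq hF n hx, Finset.smul_sum]
  refine Finset.sum_congr rfl fun r hr => ?_
  have hadm := (mem_words.1 hr).2
  have hD := mobDeriv_rev_pos hadm hx
  have hφ := (h.pos _ _ (rev_maps hadm hx).2).ne'
  set D := mobDeriv (S.rev r : SL(2, ℝ)) x
  have hs : (D : ℂ) ^ s = ((D ^ s.re : ℝ) : ℂ) * (D : ℂ) ^ (Complex.I * s.im) := by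
    rw [Complex.ofReal_cpow hD.le, ← Complex.cpow_add _ _ (by exact_mod_cast hD.ne'),
      mul_comm Complex.I, Complex.re_add_im]
  rw [_root_.map_smul, smul_smul, smul_smul, smul_smul, hs]
  congr 1
  have hφ' : ((φ (mobR (S.rev r : SL(2, ℝ)) x) : ℝ) : ℂ) ≠ 0 := by exact_mod_cast hφ
  push_cast
  field_simp

end SchottkyData

end

theorem proposition4p1 {m : ℕ} (S : SchottkyData m) :
    ∃ C : ℝ, 0 < C ∧
      ∀ (V : Type*) [NormedAddCommGroup V] [InnerProductSpace ℂ V] [FiniteDimensional ℂ V]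
        (ρ : S.Γ →* (V ≃ₗᵢ[ℂ] V)) (s : ℂ), s.re ∈ Set.Icc 0 S.δ →
      ∀ φ : ℝ → ℝ, S.IsRPFEigenfunction s.re φ →
      ∀ F : ℂ → V, S.IsOneEigenfunction s ρ F →
      ∀ (j : Fin m ⊕ Fin m) (x : ℝ), x ∈ S.Λ ∩ S.interval j →
        IsMaxOn (fun y => ‖quotientBy φ F y‖) S.Λ x →
      ∀ N : ℕ, 0 < N → ∀ a ∈ S.W N j,
        ‖quotientBy φ F x -
            ((deriv (mobR (S.word a : SL(2, ℝ))) x : ℝ) : ℂ) ^ (Complex.I * s.im) •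
              (ρ (S.word a))⁻¹ (quotientBy φ F (mobR (S.word a : SL(2, ℝ)) x))‖
          ≤ C ^ N * Real.sqrt (S.δ - s.re) * S.supNorm (quotientBy φ F) := by
  obtain ⟨C, hC⟩ := S.exists_expansionBound
  obtain ⟨B, hB⟩ := S.exists_distortionBound
  have hC1 := hC.1
  have hB1 := hB.1
  refine ⟨2 * (C ^ 4 * B), by positivity, ?_⟩
  intro V _ _ _ ρ s hσ φ hφ F hF j x hx hmax N hN a ha
  have h := hφ.isPositiveEigenfunction
  set lam := Real.exp (S.P s.re)
  have hσ1 : s.re ∈ Set.Icc (0 : ℝ) 1 := ⟨hσ.1, hσ.2.trans S.δ_le_one⟩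
  have hτ0 : 0 ≤ S.δ - s.re := sub_nonneg.2 hσ.2
  have hτ1 : S.δ - s.re ≤ 1 := by linarith [S.δ_le_one, hσ.1]
  have hadm := S.adm_reverse_of_mem_W ha
  have hrev : S.rev a.reverse = S.word a := by
    rw [SchottkyData.rev, List.reverse_reverse]
  have hlen : a.reverse.length = N := by rw [List.length_reverse]; exact ha.1
  rw [← hrev, deriv_mobR _ (SchottkyData.rev_maps hadm hx.2).1]
  set r := a.reverse
  set f := quotientBy φ F
  set u : List (Fin m ⊕ Fin m) → V := fun r =>
    ((mobDeriv (S.rev r : SL(2, ℝ)) x : ℝ) : ℂ) ^ (Complex.I * s.im) •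
      (ρ (S.rev r))⁻¹ (f (mobR (S.rev r : SL(2, ℝ)) x))
  set p : List (Fin m ⊕ Fin m) → ℝ := fun r =>
    mobDeriv (S.rev r : SL(2, ℝ)) x ^ s.re * φ (mobR (S.rev r : SL(2, ℝ)) x) / φ x
  change ‖f x - u r‖ ≤ _
  have hφx := h.pos j x hx.2
  have hu : ∀ r ∈ SchottkyData.words N j, ‖u r‖ ≤ ‖f x‖ := by
    intro r hr
    have hr' := (SchottkyData.mem_words.1 hr).2
    have h0 := (SchottkyData.rev_maps hr' hx.2).1
    have h1 := hmax (S.mobR_mem_Λ hx.1 (S.rev r) h0)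
    have h2 : ‖((mobDeriv (S.rev r : SL(2, ℝ)) x : ℝ) : ℂ) ^ (Complex.I * s.im)‖ = 1 := by
      rw [Complex.norm_cpow_eq_rpow_re_of_pos (mobDeriv_pos h0)]
      simp
    simp only [u]
    rw [norm_smul, h2, one_mul, LinearIsometryEquiv.norm_map]
    exact h1
  have hp : ∀ r ∈ SchottkyData.words N j, 0 ≤ p r := by
    intro r hr
    have hr' := (SchottkyData.mem_words.1 hr).2
    have h1 := h.pos _ _ (SchottkyData.rev_maps hr' hx.2).2
    have h2 := Real.rpow_nonneg (mobDeriv_nonneg (S.rev r : SL(2, ℝ)) x) s.re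
    simp only [p]
    positivity
  have hsum : ∑ r ∈ SchottkyData.words N j, p r = lam ^ N := by
    rw [← Finset.sum_div, ← h.iterate N hx.2, mul_div_cancel_right₀ _ hφx.ne']
  have hconv := mul_norm_sub_sq_le_of_eq_sum
    (SchottkyData.quotientBy_eq_sum h hF.eigen N hx.2) hp hu hsum
    (SchottkyData.mem_words.2 ⟨hlen, hadm⟩)
  -- By Bernoulli's inequality `lam ^ N ≤ (C ^ N) ^ (δ - σ) ≤ 1 + (δ - σ) (C ^ N - 1)`.
  have hlam := h.lam_le_rpow hσ hC hx.1 hx.2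
  have hCN : 1 ≤ C ^ N := one_le_pow₀ hC1
  have hlamN : lam ^ N - 1 ≤ (S.δ - s.re) * C ^ N := by
    have h1 : lam ^ N ≤ (C ^ N) ^ (S.δ - s.re) := by
      calc lam ^ N ≤ (C ^ (S.δ - s.re)) ^ N := pow_le_pow_left₀ h.lam_pos.le hlam N
        _ = (C ^ N) ^ (S.δ - s.re) := by
          rw [← Real.rpow_natCast, ← Real.rpow_natCast, ← Real.rpow_mul (by linarith),
            ← Real.rpow_mul (by linarith), mul_comm]
    have h2 := rpow_one_add_le_one_add_mul_self (s := C ^ N - 1) (by linarith) hτ0 hτ1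
    rw [add_sub_cancel] at h2
    nlinarith
  have hlamC : lam ≤ C := hlam.trans (Real.rpow_le_self_of_one_le hC1 hτ1)
  have hplow : 1 ≤ (C ^ 3 * B) ^ N * p r := by
    have h1 := h.le_apply_rev hσ1 hB hC hadm hx.2
    have h2 := hC.one_le_rev hadm hx.2
    rw [hlen] at h1 h2
    have hD := SchottkyData.mobDeriv_rev_pos hadm hx.2
    have hφy := h.pos _ _ (SchottkyData.rev_maps hadm hx.2).2
    have h3 : 1 ≤ C ^ N * mobDeriv (S.rev r : SL(2, ℝ)) x ^ s.re := by
      calc (1 : ℝ) ≤ (C ^ N * mobDeriv (S.rev r : SL(2, ℝ)) x) ^ s.re := Real.one_le_rpow h2 hσ.1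
        _ = (C ^ N) ^ s.re * mobDeriv (S.rev r : SL(2, ℝ)) x ^ s.re :=
            Real.mul_rpow (by positivity) hD.le
        _ ≤ _ := by
            have := Real.rpow_le_self_of_one_le hCN hσ1.2
            gcongr
    have h4 : φ x ≤ (B * C * C) ^ N * φ (mobR (S.rev r : SL(2, ℝ)) x) := by
      refine h1.trans ?_
      have := h.lam_pos
      gcongr
    have h5 : 1 ≤ (B * C * C) ^ N * φ (mobR (S.rev r : SL(2, ℝ)) x) / φ x := by
      rwa [one_le_div hφx]
    calc (1 : ℝ) = 1 * 1 := (one_mul 1).symm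
      _ ≤ (C ^ N * mobDeriv (S.rev r : SL(2, ℝ)) x ^ s.re) *
          ((B * C * C) ^ N * φ (mobR (S.rev r : SL(2, ℝ)) x) / φ x) :=
          mul_le_mul h3 h5 zero_le_one (zero_le_one.trans h3)
      _ = (C ^ 3 * B) ^ N * p r := by
          simp only [p]
          rw [show C ^ 3 * B = C * (B * C * C) by ring, mul_pow C]
          ring
  have hsup : ‖f x‖ ≤ S.supNorm f := by
    refine le_ciSup (f := fun y : S.Λ => ‖f y‖) ⟨‖f x‖, ?_⟩ ⟨x, hx.1⟩
    rintro _ ⟨y, rfl⟩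
    exact hmax y.2
  have hK : 1 ≤ (C ^ 4 * B) ^ N :=
    one_le_pow₀ (one_le_mul_of_one_le_of_one_le (one_le_pow₀ hC1) hB1)
  have hfin : ‖f x - u r‖ ^ 2 ≤
      ((2 * (C ^ 4 * B)) ^ N * Real.sqrt (S.δ - s.re) * ‖f x‖) ^ 2 := by
    calc ‖f x - u r‖ ^ 2 = 1 * ‖f x - u r‖ ^ 2 := (one_mul _).symm
      _ ≤ ((C ^ 3 * B) ^ N * p r) * ‖f x - u r‖ ^ 2 := by gcongr
      _ = (C ^ 3 * B) ^ N * (p r * ‖f x - u r‖ ^ 2) := by ring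
      _ ≤ (C ^ 3 * B) ^ N * (2 * (lam ^ N - 1) * ‖f x‖ ^ 2) := by gcongr
      _ ≤ (C ^ 3 * B) ^ N * (2 * ((S.δ - s.re) * C ^ N) * ‖f x‖ ^ 2) := by gcongr
      _ = 2 * (C ^ 4 * B) ^ N * ((S.δ - s.re) * ‖f x‖ ^ 2) := by
          rw [show C ^ 4 * B = C ^ 3 * B * C by ring, mul_pow _ C]
          ring
      _ ≤ ((2 * (C ^ 4 * B)) ^ N) ^ 2 * ((S.δ - s.re) * ‖f x‖ ^ 2) := by
          have h1 : (2 : ℝ) ≤ 2 ^ N := le_self_pow₀ one_le_two hN.ne'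
          have h2 : 2 * (C ^ 4 * B) ^ N ≤ (2 * (C ^ 4 * B)) ^ N := by
            rw [mul_pow 2]; gcongr
          have h3 : 2 * (C ^ 4 * B) ^ N ≤ ((2 * (C ^ 4 * B)) ^ N) ^ 2 :=
            h2.trans (le_self_pow₀ (by linarith) two_ne_zero)
          gcongr
      _ = _ := by 
          rw [mul_pow (_ * _) ‖f x‖, mul_pow _ (Real.sqrt _), Real.sq_sqrt hτ0]; ring
  have hroot := (sq_le_sq₀ (norm_nonneg _) (by positivity)).1 hfin
  exact hroot.trans (by gcongr)
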